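/- **Conventions.** "Countable" means at most countable. A $0$-lattice is a lattice with a least element $0$, and a $0$-lattice homomorphism is a lattice homomorphism preserving $0$. A distributive $0$-lattice $L$ is *completely normal* if for all $a,b\in L$ there are $u,v\in L$ with $a\le u\vee b$, $b\le a\vee v$ and $u\wedge v=0$. Let $\Bbbk$ be a totally ordered division ring. For a set $I$, let $\Bbbk^{(I)}$ be the set of all finitely supported families $(x_i)_{i\in I}$ of elements of $\Bbbk$; each $a\in\Bbbk^{(I)}$ defines the functional $x\mapsto a(x)=\sum_{i\in I}a_ix_i$ on $\Bbbk^{(I)}$. Let $\mathrm{Op}^-(\Bbbk^{(I)},\Bbbk^{(I)})$ be the sublattice of the powerset of $\Bbbk^{(I)}$ generated by all sets $\{x: a(x)>0\}$ and $\{x: a(x)<0\}$ with $a\in\Bbbk^{(I)}$; its least element is $\varnothing$. For $I\subseteq J$, let $\varepsilon_{I,J}\colon\mathrm{Op}^-(\Bbbk^{(I)},\Bbbk^{(I)})\to\mathrm{Op}^-(\Bbbk^{(J)},\Bbbk^{(J)})$ be the lattice homomorphism $X\mapsto\{y\in\Bbbk^{(J)}: y|_I\in X\}$. A left $\Bbbk$-vector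 lattice is a left $\Bbbk$-vector space that is a lattice-ordered Abelian group in which multiplication by nonnegative scalars is isotone; an $\ell$-ideal of it is an order-convex vector subspace closed under $\vee$ and $\wedge$; $\mathrm{Id}_c V$ is the $0$-lattice of all principal $\ell$-ideals $\langle a\rangle$ of $V$ (that is, $\ell$-ideals generated by a single element $a$), ordered by inclusion. Let $\mathrm{F}_\ell(I,\Bbbk)$ be the free left $\Bbbk$-vector lattice on $I$ and, for $I\subseteq J$, let $\eta_{I,J}\colon\mathrm{Id}_c\mathrm{F}_\ell(I,\Bbbk)\to\mathrm{Id}_c\mathrm{F}_\ell(J,\Bbbk)$, $\langle a\rangle\mapsto\langle\iota(a)\rangle$, where $\iota\colon\mathrm{F}_\ell(I,\Bbbk)\to\mathrm{F}_\ell(J,\Bbbk)$ is the vector lattice homomorphism sending each generator $i\in I$ to the generator $i$. **Theorem.** Let $\Bbbk$ be a countable totally ordered division ring, let $I$ and $J$ be countable sets with $I\subset J$ and $J\setminus I$ infinite, let $K$ and $L$ be distributive $0$-lattices with $L$ countable and completely normal, and let $\varphi\colon K\to L$ be a $0$-lattice homomorphism. 1. For every $0$-lattice homomorphism $f\colon\mathrm{Op}^-(\Bbbk^{(I)},\Bbbk^{(I)})\to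 K$ there exists a surjective lattice homomorphism $g\colon\mathrm{Op}^-(\Bbbk^{(J)},\Bbbk^{(J)})\to L$ such that $g\circ\varepsilon_{I,J}=\varphi\circ f$. 2. For every $0$-lattice homomorphism $f\colon\mathrm{Id}_c\mathrm{F}_\ell(I,\Bbbk)\to K$ there exists a surjective lattice homomorphism $g\colon\mathrm{Id}_c\mathrm{F}_\ell(J,\Bbbk)\to L$ such that $g\circ\eta_{I,J}=\varphi\circ f$. -/

import Mathlib

/-! ### Completely normal lattices -/

/-- A lattice with bottom element is completely normal if any two of its elements `a`, `b` are
consonant: `a ≤ u ⊔ b`, `b ≤ a ⊔ v` and `u ⊓ v = ⊥` for some `u`, `v`. -/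
def CompletelyNormal (L : Type*) [Lattice L] [OrderBot L] : Prop :=
  ∀ a b : L, ∃ u v : L, a ≤ u ⊔ b ∧ b ≤ a ⊔ v ∧ u ⊓ v = ⊥

/-! ### The lattices `Op⁻` -/

section OpMinus

set_option linter.unusedSectionVars false

/-- `Op⁻(F, Ω)`: the sublattice of the powerset of `Ω` generated by all sets `{x | f x > 0}` and
`{x | f x < 0}` for `f ∈ F`. -/
def OpMinus {k Ω : Type*} [Zero k] [LT k] (F : Set (Ω → k)) : Sublattice (Set Ω) :=
  Sublattice.ofIsSublattice
    (latticeClosure {U : Set Ω | ∃ f ∈ F, U = {x | 0 < f x} ∨ U = {x | f x < 0}})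
    isSublattice_latticeClosure

/-- The linear functional `x ↦ ∑ i, a i * x i` on the right vector space `k^(I)` given by an element
`a` of the left vector space `k^(I)`. -/
noncomputable def linFunctional {k I : Type*} [DivisionRing k] (a x : I →₀ k) : k :=
  a.sum fun i c => c * x i

variable (k : Type*) [DivisionRing k] [LinearOrder k]

/-- `Op⁻(k^(I), k^(I))`. -/
def OpSpace (I : Type*) : Sublattice (Set (I →₀ k)) :=
  OpMinus (Set.range (linFunctional (k := k) (I := I)))

variable {k} in
theorem empty_mem_opSpace (I : Type*) : (∅ : Set (I →₀ k)) ∈ OpSpace k I := by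
  refine subset_latticeClosure ⟨linFunctional 0, ⟨0, rfl⟩, Or.inl ?_⟩
  ext x
  simp [linFunctional]

instance OpSpace.instOrderBot (I : Type*) : OrderBot (OpSpace k I) where
  bot := ⟨∅, empty_mem_opSpace I⟩
  bot_le X := Set.empty_subset (X : Set (I →₀ k))

variable {J : Type*} (I : Set J)

/-- `ε_{I,J}` on powersets: the set of all `y ∈ k^(J)` whose restriction to `I` is in `X`. -/
def epsSet (X : Set (I →₀ k)) : Set (J →₀ k) :=
  {y | y.subtypeDomain (· ∈ I) ∈ X}

variable {k}

theorem linFunctional_mapDomain (a : I →₀ k) (y : J →₀ k) :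
    linFunctional (a.mapDomain Subtype.val) y = linFunctional a (y.subtypeDomain (· ∈ I)) := by
  unfold linFunctional
  rw [Finsupp.sum_mapDomain_index (by simp) (by intros; rw [add_mul])]
  rfl

theorem epsSet_mem {X : Set (I →₀ k)} (hX : X ∈ OpSpace k I) : epsSet k I X ∈ OpSpace k J := by
  have key : latticeClosure {U : Set (I →₀ k) |
      ∃ f ∈ Set.range (linFunctional (k := k) (I := I)), U = {x | 0 < f x} ∨ U = {x | f x < 0}} ⊆
      {X : Set (I →₀ k) | epsSet k I X ∈ OpSpace k J} := by
    refine latticeClosure_min ?_ ⟨?_, ?_⟩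
    · rintro U ⟨_, ⟨a, rfl⟩, hU⟩
      refine subset_latticeClosure
        ⟨linFunctional (a.mapDomain Subtype.val), ⟨_, rfl⟩, ?_⟩
      rcases hU with rfl | rfl
      · left; ext y; simp only [epsSet, Set.mem_ofPred_eq, linFunctional_mapDomain]
      · right; ext y; simp only [epsSet, Set.mem_ofPred_eq, linFunctional_mapDomain]
    · intro A hA B hB
      exact (OpSpace k J).sup_mem hA hB
    · intro A hA B hB
      exact (OpSpace k J).inf_mem hA hB
  exact key hX

variable (k)

/-- `ε_{I,J}` as a lattice homomorphism from `Op⁻(k^(I), k^(I))` to `Op⁻(k^(J), k^(J))`. -/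
def eps : LatticeHom (OpSpace k I) (OpSpace k J) where
  toFun X := ⟨epsSet k I X, epsSet_mem I X.2⟩
  map_sup' _ _ := rfl
  map_inf' _ _ := rfl

end OpMinus

/-! ### Vector lattices and their principal `ℓ`-ideals

A (left) `k`-vector lattice is a left `k`-module `V` which is a lattice-ordered abelian group in
which multiplication by nonnegative scalars is monotone. -/

section VectorLattice

set_option linter.unusedSectionVars false

variable {k : Type*} [DivisionRing k] [LinearOrder k] [IsStrictOrderedRing k]
variable {V : Type*} [AddCommGroup V] [Lattice V] [IsOrderedAddMonoid V] [Module k V]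
  [PosSMulMono k V]

theorem VectorLattice.posSMulReflectLE : PosSMulReflectLE k V where
  le_of_smul_le_smul_left c hc x y h := by
    have := smul_le_smul_of_nonneg_left h (inv_nonneg.2 hc.le)
    rwa [inv_smul_smul₀ hc.ne', inv_smul_smul₀ hc.ne'] at this

theorem VectorLattice.smul_sup {c : k} (hc : 0 ≤ c) (x y : V) :
    c • (x ⊔ y) = c • x ⊔ c • y := by
  rcases hc.eq_or_lt with rfl | hc
  · simp
  · have := VectorLattice.posSMulReflectLE (k := k) (V := V)
    exact (OrderIso.smulRight (β := V) hc).map_sup x y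

theorem VectorLattice.smul_inf {c : k} (hc : 0 ≤ c) (x y : V) :
    c • (x ⊓ y) = c • x ⊓ c • y := by
  rcases hc.eq_or_lt with rfl | hc
  · simp
  · have := VectorLattice.posSMulReflectLE (k := k) (V := V)
    exact (OrderIso.smulRight (β := V) hc).map_inf x y

theorem VectorLattice.smul_le_smul_right {c d : k} (h : c ≤ d) {x : V} (hx : 0 ≤ x) :
    c • x ≤ d • x := by
  have : 0 ≤ (d - c) • x := smul_nonneg (sub_nonneg.2 h) hx
  rwa [sub_smul, sub_nonneg] at this

theorem VectorLattice.abs_smul_le (c : k) (x : V) : |c • x| ≤ |c| • |x| := by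
  have h : ∀ y : V, c • y ≤ |c| • |y| := by
    intro y
    rcases le_total 0 c with hc | hc
    · rw [abs_of_nonneg hc]
      exact smul_le_smul_of_nonneg_left (le_abs_self y) hc
    · rw [abs_of_nonpos hc, ← neg_smul_neg c y]
      exact smul_le_smul_of_nonneg_left (neg_le_abs y) (neg_nonneg.2 hc)
  refine abs_le'.2 ⟨h x, ?_⟩
  have := h (-x)
  rwa [smul_neg, abs_neg] at this

/-- An `ℓ`-ideal of a `k`-vector lattice: an order-convex vector subspace closed under the lattice
operations. -/
structure IsLIdeal (S : Submodule k V) : Prop where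
  convex : ∀ ⦃x y z : V⦄, x ∈ S → z ∈ S → x ≤ y → y ≤ z → y ∈ S
  sup_mem : ∀ ⦃x y : V⦄, x ∈ S → y ∈ S → x ⊔ y ∈ S
  inf_mem : ∀ ⦃x y : V⦄, x ∈ S → y ∈ S → x ⊓ y ∈ S

variable (k) in
/-- The principal `ℓ`-ideal `⟨a⟩`; it is the least `ℓ`-ideal containing `a`, see
`principalLIdeal_isLeast`. -/
def principalLIdeal (a : V) : Submodule k V where
  carrier := {x | ∃ c : k, 0 ≤ c ∧ |x| ≤ c • |a|}
  add_mem' := by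
    rintro x y ⟨c, hc, hx⟩ ⟨d, hd, hy⟩
    refine ⟨c + d, add_nonneg hc hd, (abs_add_le x y).trans ?_⟩
    rw [add_smul]
    exact add_le_add hx hy
  zero_mem' := ⟨0, le_rfl, by simp⟩
  smul_mem' := by
    rintro r x ⟨c, hc, hx⟩
    refine ⟨|r| * c, mul_nonneg (abs_nonneg r) hc, (VectorLattice.abs_smul_le r x).trans ?_⟩
    rw [mul_smul]
    exact smul_le_smul_of_nonneg_left hx (abs_nonneg r)

theorem mem_principalLIdeal {a x : V} :
    x ∈ principalLIdeal k a ↔ ∃ c : k, 0 ≤ c ∧ |x| ≤ c • |a| := Iff.rfl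

theorem self_mem_principalLIdeal (a : V) : a ∈ principalLIdeal k a :=
  ⟨1, zero_le_one, by simp⟩

theorem IsLIdeal.abs_mem {S : Submodule k V} (hS : IsLIdeal S) {x : V} (hx : x ∈ S) : |x| ∈ S :=
  hS.sup_mem hx (S.neg_mem hx)

theorem IsLIdeal.mem_of_abs_le {S : Submodule k V} (hS : IsLIdeal S) {x y : V} (hy : y ∈ S)
    (h : |x| ≤ y) : x ∈ S :=
  hS.convex (S.neg_mem hy) hy (neg_le.1 ((neg_le_abs x).trans h)) ((le_abs_self x).trans h)

theorem principalLIdeal_isLIdeal (a : V) : IsLIdeal (principalLIdeal k a) := by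
  have bound : ∀ {x y z : V}, x ∈ principalLIdeal k a → z ∈ principalLIdeal k a →
      |y| ≤ |x| + |z| → y ∈ principalLIdeal k a := by
    rintro x y z ⟨c, hc, hx⟩ ⟨d, hd, hz⟩ h
    refine ⟨c + d, add_nonneg hc hd, h.trans ?_⟩
    rw [add_smul]
    exact add_le_add hx hz
  have h1 : ∀ u v : V, u ≤ |u| + |v| := fun u v =>
    (le_abs_self u).trans (le_add_of_nonneg_right (abs_nonneg v))
  have h2 : ∀ u v : V, v ≤ |u| + |v| := fun u v =>
    (le_abs_self v).trans (le_add_of_nonneg_left (abs_nonneg u))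
  have h3 : ∀ u v : V, -u ≤ |u| + |v| := fun u v => by simpa using h1 (-u) (-v)
  have h4 : ∀ u v : V, -v ≤ |u| + |v| := fun u v => by simpa using h2 (-u) (-v)
  refine ⟨?_, ?_, ?_⟩
  · intro x y z hx hz hxy hyz
    exact bound hx hz (abs_le'.2 ⟨hyz.trans (h2 x z), (neg_le_neg hxy).trans (h3 x z)⟩)
  · intro x y hx hy
    refine bound hx hy (abs_le'.2 ⟨sup_le (h1 x y) (h2 x y), ?_⟩)
    exact (neg_le_neg le_sup_left).trans (h3 x y)
  · intro x y hx hy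
    refine bound hx hy (abs_le'.2 ⟨inf_le_left.trans (h1 x y), ?_⟩)
    rw [neg_inf]
    exact sup_le (h3 x y) (h4 x y)

theorem IsLIdeal.principal_le {S : Submodule k V} (hS : IsLIdeal S) {a : V} (ha : a ∈ S) :
    principalLIdeal k a ≤ S := by
  rintro x ⟨c, _, hx⟩
  exact hS.mem_of_abs_le (S.smul_mem c (hS.abs_mem ha)) hx

theorem principalLIdeal_isLeast (a : V) :
    IsLeast {S : Submodule k V | IsLIdeal S ∧ a ∈ S} (principalLIdeal k a) :=
  ⟨⟨principalLIdeal_isLIdeal a, self_mem_principalLIdeal a⟩, fun _ hS => hS.1.principal_le hS.2⟩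

theorem principalLIdeal_le_iff {a b : V} :
    principalLIdeal k a ≤ principalLIdeal k b ↔ a ∈ principalLIdeal k b :=
  ⟨fun h => h (self_mem_principalLIdeal a), fun h => (principalLIdeal_isLIdeal b).principal_le h⟩

theorem principalLIdeal_sup (a b : V) :
    principalLIdeal k a ⊔ principalLIdeal k b = principalLIdeal k (|a| + |b|) := by
  have hab : |(|a| + |b|)| = |a| + |b| := abs_of_nonneg (add_nonneg (abs_nonneg a) (abs_nonneg b))
  apply le_antisymm
  · refine sup_le (principalLIdeal_le_iff.2 ⟨1, zero_le_one, ?_⟩)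
      (principalLIdeal_le_iff.2 ⟨1, zero_le_one, ?_⟩)
    · rw [hab, one_smul]; exact le_add_of_nonneg_right (abs_nonneg b)
    · rw [hab, one_smul]; exact le_add_of_nonneg_left (abs_nonneg a)
  · have pos : ∀ y : V, 0 ≤ y → y ∈ principalLIdeal k (|a| + |b|) →
        y ∈ principalLIdeal k a ⊔ principalLIdeal k b := by
      rintro y hy ⟨c, hc, h⟩
      rw [hab, abs_of_nonneg hy, smul_add] at h
      have hca : 0 ≤ c • |a| := smul_nonneg hc (abs_nonneg a)
      have hcb : 0 ≤ c • |b| := smul_nonneg hc (abs_nonneg b)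
      have hd : 0 ≤ y - y ⊓ c • |a| := sub_nonneg.2 inf_le_left
      refine Submodule.mem_sup.2 ⟨y ⊓ c • |a|, ⟨c, hc, ?_⟩, y - y ⊓ c • |a|, ⟨c, hc, ?_⟩, by abel⟩
      · rw [abs_of_nonneg (le_inf hy hca)]; exact inf_le_right
      · rw [abs_of_nonneg hd, sub_le_comm]
        refine le_inf (sub_le_self y hcb) ?_
        rwa [sub_le_iff_le_add]
    intro x hx
    have hI := principalLIdeal_isLIdeal (k := k) (|a| + |b|)
    have e : x = (x ⊔ 0) - (-x ⊔ 0) := (posPart_sub_negPart x).symm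
    rw [e]
    exact Submodule.sub_mem _ (pos _ le_sup_right (hI.sup_mem hx (Submodule.zero_mem _)))
      (pos _ le_sup_right (hI.sup_mem (Submodule.neg_mem _ hx) (Submodule.zero_mem _)))

theorem principalLIdeal_inf (a b : V) :
    principalLIdeal k a ⊓ principalLIdeal k b = principalLIdeal k (|a| ⊓ |b|) := by
  have hab : |(|a| ⊓ |b|)| = |a| ⊓ |b| := abs_of_nonneg (le_inf (abs_nonneg a) (abs_nonneg b))
  apply le_antisymm
  · rintro x ⟨⟨c, hc, hx⟩, ⟨d, hd, hx'⟩⟩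
    refine ⟨max c d, hc.trans (le_max_left c d), ?_⟩
    rw [hab, VectorLattice.smul_inf (hc.trans (le_max_left c d))]
    exact le_inf (hx.trans (VectorLattice.smul_le_smul_right (le_max_left c d) (abs_nonneg a)))
      (hx'.trans (VectorLattice.smul_le_smul_right (le_max_right c d) (abs_nonneg b)))
  · refine le_inf (principalLIdeal_le_iff.2 ⟨1, zero_le_one, ?_⟩)
      (principalLIdeal_le_iff.2 ⟨1, zero_le_one, ?_⟩)
    · rw [hab, one_smul]; exact inf_le_left
    · rw [hab, one_smul]; exact inf_le_right

variable (k V) in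
/-- `Id_c V`: the lattice, under inclusion, of all principal `ℓ`-ideals of the `k`-vector lattice
`V`. -/
def Idc : Sublattice (Submodule k V) where
  carrier := Set.range (principalLIdeal k)
  supClosed' := by
    rintro _ ⟨a, rfl⟩ _ ⟨b, rfl⟩
    exact ⟨_, (principalLIdeal_sup a b).symm⟩
  infClosed' := by
    rintro _ ⟨a, rfl⟩ _ ⟨b, rfl⟩
    exact ⟨_, (principalLIdeal_inf a b).symm⟩

variable (k) in
/-- The principal `ℓ`-ideal `⟨a⟩` as an element of `Id_c V`. -/
def Idc.mk (a : V) : Idc k V := ⟨principalLIdeal k a, a, rfl⟩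

theorem Idc.exists_mk (S : Idc k V) : ∃ a : V, Idc.mk k a = S :=
  ⟨S.2.choose, Subtype.ext S.2.choose_spec⟩

theorem Idc.mk_le_mk {a b : V} :
    Idc.mk k a ≤ Idc.mk k b ↔ ∃ c : k, 0 ≤ c ∧ |a| ≤ c • |b| :=
  principalLIdeal_le_iff

theorem Idc.mk_sup_mk (a b : V) : Idc.mk k a ⊔ Idc.mk k b = Idc.mk k (|a| + |b|) :=
  Subtype.ext (principalLIdeal_sup a b)

theorem Idc.mk_inf_mk (a b : V) : Idc.mk k a ⊓ Idc.mk k b = Idc.mk k (|a| ⊓ |b|) :=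
  Subtype.ext (principalLIdeal_inf a b)

instance Idc.instOrderBot : OrderBot (Idc k V) where
  bot := Idc.mk k 0
  bot_le S := by
    obtain ⟨a, rfl⟩ := (Idc.exists_mk S)
    exact Idc.mk_le_mk.2 ⟨0, le_rfl, by simp⟩

variable (k V) in
/-- A homomorphism of `k`-vector lattices. -/
structure VectorLatticeHom (W : Type*) [AddCommGroup W] [Lattice W] [Module k W]
    extends V →ₗ[k] W where
  map_sup' : ∀ x y : V, toFun (x ⊔ y) = toFun x ⊔ toFun y
  map_inf' : ∀ x y : V, toFun (x ⊓ y) = toFun x ⊓ toFun y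

variable {W : Type*} [AddCommGroup W] [Lattice W] [IsOrderedAddMonoid W] [Module k W]
  [PosSMulMono k W]

theorem VectorLatticeHom.map_abs (h : VectorLatticeHom k V W) (x : V) :
    h.toLinearMap |x| = |h.toLinearMap x| := by
  have := h.map_sup' x (-x)
  change h.toLinearMap (x ⊔ -x) = h.toLinearMap x ⊔ h.toLinearMap (-x) at this
  rw [map_neg] at this
  exact this

theorem VectorLatticeHom.mono (h : VectorLatticeHom k V W) {x y : V} (hxy : x ≤ y) :
    h.toLinearMap x ≤ h.toLinearMap y := by
  have := h.map_sup' x y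
  rw [sup_eq_right.2 hxy] at this
  exact sup_eq_right.1 this.symm

theorem VectorLatticeHom.mk_mono (h : VectorLatticeHom k V W) {a b : V}
    (hab : Idc.mk k a ≤ Idc.mk k b) :
    Idc.mk k (h.toLinearMap a) ≤ Idc.mk k (h.toLinearMap b) := by
  obtain ⟨c, hc, hle⟩ := Idc.mk_le_mk.1 hab
  refine Idc.mk_le_mk.2 ⟨c, hc, ?_⟩
  have := h.mono hle
  rwa [map_smul, h.map_abs, h.map_abs] at this

/-- The underlying map of `Id_c h` for a homomorphism `h` of vector lattices, namely
`⟨a⟩ ↦ ⟨h a⟩`, see `idcMapFun_mk`. -/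
noncomputable def idcMapFun (h : VectorLatticeHom k V W) (S : Idc k V) : Idc k W :=
  Idc.mk k (h.toLinearMap (Idc.exists_mk S).choose)

theorem idcMapFun_mk (h : VectorLatticeHom k V W) (a : V) :
    idcMapFun h (Idc.mk k a) = Idc.mk k (h.toLinearMap a) :=
  le_antisymm (h.mk_mono (Idc.exists_mk (Idc.mk k a)).choose_spec.le)
    (h.mk_mono (Idc.exists_mk (Idc.mk k a)).choose_spec.ge)

/-- `Id_c h`, as a lattice homomorphism. -/
noncomputable def idcMap (h : VectorLatticeHom k V W) : LatticeHom (Idc k V) (Idc k W) where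
  toFun := idcMapFun h
  map_sup' S T := by
    obtain ⟨a, rfl⟩ := (Idc.exists_mk S)
    obtain ⟨b, rfl⟩ := (Idc.exists_mk T)
    rw [Idc.mk_sup_mk, idcMapFun_mk, idcMapFun_mk, idcMapFun_mk, Idc.mk_sup_mk, map_add,
      h.map_abs, h.map_abs]
  map_inf' S T := by
    obtain ⟨a, rfl⟩ := (Idc.exists_mk S)
    obtain ⟨b, rfl⟩ := (Idc.exists_mk T)
    have := h.map_inf' |a| |b|
    change h.toLinearMap (|a| ⊓ |b|) = h.toLinearMap |a| ⊓ h.toLinearMap |b| at this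
    rw [Idc.mk_inf_mk, idcMapFun_mk, idcMapFun_mk, idcMapFun_mk, Idc.mk_inf_mk, this,
      h.map_abs, h.map_abs]

theorem idcMap_mk (h : VectorLatticeHom k V W) (a : V) :
    idcMap h (Idc.mk k a) = Idc.mk k (h.toLinearMap a) :=
  idcMapFun_mk h a

end VectorLattice

/-! ### The free `k`-vector lattice on a set -/

/-- Terms in the language of `k`-vector lattices, with variables in `X`. -/
inductive VLTerm (k X : Type*) where
  | of : X → VLTerm k X
  | zero : VLTerm k X
  | add : VLTerm k X → VLTerm k X → VLTerm k X
  | neg : VLTerm k X → VLTerm k X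
  | smul : k → VLTerm k X → VLTerm k X
  | sup : VLTerm k X → VLTerm k X → VLTerm k X
  | inf : VLTerm k X → VLTerm k X → VLTerm k X

namespace VLTerm

/-- The least congruence on terms containing all instances of the axioms of `k`-vector lattices. -/
inductive Rel {k X : Type*} [DivisionRing k] [LinearOrder k] : VLTerm k X → VLTerm k X → Prop
  | refl (a) : Rel a a
  | symm {a b} : Rel a b → Rel b a
  | trans {a b c} : Rel a b → Rel b c → Rel a c
  | add_congr {a a' b b'} : Rel a a' → Rel b b' → Rel (add a b) (add a' b')
  | neg_congr {a a'} : Rel a a' → Rel (neg a) (neg a')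
  | smul_congr (r) {a a'} : Rel a a' → Rel (smul r a) (smul r a')
  | sup_congr {a a' b b'} : Rel a a' → Rel b b' → Rel (sup a b) (sup a' b')
  | inf_congr {a a' b b'} : Rel a a' → Rel b b' → Rel (inf a b) (inf a' b')
  | add_assoc (a b c) : Rel (add (add a b) c) (add a (add b c))
  | add_comm (a b) : Rel (add a b) (add b a)
  | zero_add (a) : Rel (add zero a) a
  | neg_add (a) : Rel (add (neg a) a) zero
  | one_smul (a) : Rel (smul 1 a) a
  | mul_smul (r s a) : Rel (smul (r * s) a) (smul r (smul s a))
  | smul_add (r a b) : Rel (smul r (add a b)) (add (smul r a) (smul r b))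
  | add_smul (r s a) : Rel (smul (r + s) a) (add (smul r a) (smul s a))
  | sup_comm (a b) : Rel (sup a b) (sup b a)
  | sup_assoc (a b c) : Rel (sup (sup a b) c) (sup a (sup b c))
  | inf_comm (a b) : Rel (inf a b) (inf b a)
  | inf_assoc (a b c) : Rel (inf (inf a b) c) (inf a (inf b c))
  | sup_inf_self (a b) : Rel (sup a (inf a b)) a
  | inf_sup_self (a b) : Rel (inf a (sup a b)) a
  | add_sup (a b c) : Rel (add a (sup b c)) (sup (add a b) (add a c))
  | smul_sup (r) (hr : 0 ≤ r) (a b) : Rel (smul r (sup a b)) (sup (smul r a) (smul r b))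

/-- The value of a term in a vector lattice, at a given assignment of the variables. -/
def eval {k X V : Type*} [DivisionRing k] [AddCommGroup V] [Lattice V] [Module k V] (v : X → V) :
    VLTerm k X → V
  | of x => v x
  | zero => 0
  | add a b => eval v a + eval v b
  | neg a => -eval v a
  | smul r a => r • eval v a
  | sup a b => eval v a ⊔ eval v b
  | inf a b => eval v a ⊓ eval v b

variable {k X V : Type*} [DivisionRing k] [LinearOrder k]

theorem Rel.eval_eq [IsStrictOrderedRing k] [AddCommGroup V] [Lattice V] [IsOrderedAddMonoid V]
    [Module k V] [PosSMulMono k V] (v : X → V) {a b : VLTerm k X} (h : Rel a b) :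
    eval v a = eval v b := by
  induction h with
  | refl => rfl
  | symm _ ih => exact ih.symm
  | trans _ _ ih₁ ih₂ => exact ih₁.trans ih₂
  | add_congr _ _ ih₁ ih₂ => simp only [eval, ih₁, ih₂]
  | neg_congr _ ih => simp only [eval, ih]
  | smul_congr _ _ ih => simp only [eval, ih]
  | sup_congr _ _ ih₁ ih₂ => simp only [eval, ih₁, ih₂]
  | inf_congr _ _ ih₁ ih₂ => simp only [eval, ih₁, ih₂]
  | add_assoc => exact _root_.add_assoc _ _ _
  | add_comm => exact _root_.add_comm _ _
  | zero_add => exact _root_.zero_add _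
  | neg_add => exact neg_add_cancel _
  | one_smul => exact _root_.one_smul _ _
  | mul_smul => exact SemigroupAction.mul_smul _ _ _
  | smul_add => exact _root_.smul_add _ _ _
  | add_smul => exact _root_.add_smul _ _ _
  | sup_comm => exact _root_.sup_comm _ _
  | sup_assoc => exact _root_.sup_assoc _ _ _
  | inf_comm => exact _root_.inf_comm _ _
  | inf_assoc => exact _root_.inf_assoc _ _ _
  | sup_inf_self => exact _root_.sup_inf_self
  | inf_sup_self => exact _root_.inf_sup_self
  | add_sup => exact _root_.add_sup _ _ _
  | smul_sup r hr => exact VectorLattice.smul_sup hr _ _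

/-- The setoid of provable equality of terms. -/
def setoid (k X : Type*) [DivisionRing k] [LinearOrder k] : Setoid (VLTerm k X) :=
  ⟨Rel, Rel.refl, Rel.symm, Rel.trans⟩

end VLTerm

/-- `F_ℓ(X, k)`: the free left `k`-vector lattice on `X`. -/
def FreeVL (k X : Type*) [DivisionRing k] [LinearOrder k] : Type _ :=
  Quotient (VLTerm.setoid k X)

namespace FreeVL

section Instances

variable {k X : Type*} [DivisionRing k] [LinearOrder k]

open VLTerm (Rel)

/-- The canonical generators. -/
def of (x : X) : FreeVL k X := Quotient.mk (VLTerm.setoid k X) (VLTerm.of x)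

instance : Zero (FreeVL k X) := ⟨Quotient.mk (VLTerm.setoid k X) VLTerm.zero⟩

instance : Add (FreeVL k X) :=
  ⟨Quotient.map₂ VLTerm.add fun _ _ h _ _ h' => Rel.add_congr h h'⟩

instance : Neg (FreeVL k X) := ⟨Quotient.map VLTerm.neg fun _ _ h => Rel.neg_congr h⟩

instance : SMul k (FreeVL k X) :=
  ⟨fun r => Quotient.map (VLTerm.smul r) fun _ _ h => Rel.smul_congr r h⟩

instance : AddCommGroup (FreeVL k X) where
  add_assoc := by
    rintro ⟨a⟩ ⟨b⟩ ⟨c⟩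
    exact Quotient.sound (Rel.add_assoc a b c)
  zero_add := by
    rintro ⟨a⟩
    exact Quotient.sound (Rel.zero_add a)
  add_zero := by
    rintro ⟨a⟩
    exact Quotient.sound ((Rel.add_comm a _).trans (Rel.zero_add a))
  neg_add_cancel := by
    rintro ⟨a⟩
    exact Quotient.sound (Rel.neg_add a)
  add_comm := by
    rintro ⟨a⟩ ⟨b⟩
    exact Quotient.sound (Rel.add_comm a b)
  nsmul := nsmulRec
  zsmul := zsmulRec

theorem smul_add_aux (r : k) (a b : FreeVL k X) : r • (a + b) = r • a + r • b := by
  obtain ⟨a⟩ := a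
  obtain ⟨b⟩ := b
  exact Quotient.sound (Rel.smul_add r a b)

theorem add_smul_aux (r s : k) (a : FreeVL k X) : (r + s) • a = r • a + s • a := by
  obtain ⟨a⟩ := a
  exact Quotient.sound (Rel.add_smul r s a)

instance : Module k (FreeVL k X) where
  one_smul := by
    rintro ⟨a⟩
    exact Quotient.sound (Rel.one_smul a)
  mul_smul r s := by
    rintro ⟨a⟩
    exact Quotient.sound (Rel.mul_smul r s a)
  smul_add := smul_add_aux
  add_smul := add_smul_aux
  smul_zero r := by
    have h := smul_add_aux r (0 : FreeVL k X) 0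
    rw [add_zero] at h
    exact left_eq_add.1 h
  zero_smul a := by
    have h := add_smul_aux 0 0 a
    rw [add_zero] at h
    exact left_eq_add.1 h

instance : Lattice (FreeVL k X) :=
  letI : Max (FreeVL k X) :=
    ⟨Quotient.map₂ VLTerm.sup fun _ _ h _ _ h' => Rel.sup_congr h h'⟩
  letI : Min (FreeVL k X) :=
    ⟨Quotient.map₂ VLTerm.inf fun _ _ h _ _ h' => Rel.inf_congr h h'⟩
  Lattice.mk'
    (by rintro ⟨a⟩ ⟨b⟩; exact Quotient.sound (Rel.sup_comm a b))
    (by rintro ⟨a⟩ ⟨b⟩ ⟨c⟩; exact Quotient.sound (Rel.sup_assoc a b c))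
    (by rintro ⟨a⟩ ⟨b⟩; exact Quotient.sound (Rel.inf_comm a b))
    (by rintro ⟨a⟩ ⟨b⟩ ⟨c⟩; exact Quotient.sound (Rel.inf_assoc a b c))
    (by rintro ⟨a⟩ ⟨b⟩; exact Quotient.sound (Rel.sup_inf_self a b))
    (by rintro ⟨a⟩ ⟨b⟩; exact Quotient.sound (Rel.inf_sup_self a b))

theorem add_sup_aux (a b c : FreeVL k X) : a + (b ⊔ c) = (a + b) ⊔ (a + c) := by
  obtain ⟨a⟩ := a
  obtain ⟨b⟩ := b
  obtain ⟨c⟩ := c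
  exact Quotient.sound (Rel.add_sup a b c)

theorem smul_sup_aux {r : k} (hr : 0 ≤ r) (a b : FreeVL k X) :
    r • (a ⊔ b) = r • a ⊔ r • b := by
  obtain ⟨a⟩ := a
  obtain ⟨b⟩ := b
  exact Quotient.sound (Rel.smul_sup r hr a b)

instance : IsOrderedAddMonoid (FreeVL k X) where
  add_le_add_left a b h c := by
    rw [add_comm a c, add_comm b c, ← sup_eq_right, ← add_sup_aux, sup_eq_right.2 h]

instance : PosSMulMono k (FreeVL k X) where
  smul_le_smul_of_nonneg_left r hr a b h := by
    rw [← sup_eq_right, ← smul_sup_aux hr, sup_eq_right.2 h]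

end Instances

variable {k X : Type*} [DivisionRing k] [LinearOrder k] [IsStrictOrderedRing k]
variable {V : Type*} [AddCommGroup V] [Lattice V] [IsOrderedAddMonoid V] [Module k V]
  [PosSMulMono k V]

/-- The homomorphism of vector lattices from the free one that extends a given map on the
generators. -/
def lift (v : X → V) : VectorLatticeHom k (FreeVL k X) V where
  toFun := Quotient.lift (VLTerm.eval v) fun _ _ h => VLTerm.Rel.eval_eq v h
  map_add' := by rintro ⟨a⟩ ⟨b⟩; rfl
  map_smul' := by rintro r ⟨a⟩; rfl
  map_sup' := by rintro ⟨a⟩ ⟨b⟩; rfl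
  map_inf' := by rintro ⟨a⟩ ⟨b⟩; rfl

theorem lift_of (v : X → V) (x : X) : (lift (k := k) v).toLinearMap (of x) = v x := rfl

theorem lift_unique (v : X → V) (h : VectorLatticeHom k (FreeVL k X) V)
    (hv : ∀ x, h.toLinearMap (of x) = v x) (a : FreeVL k X) :
    h.toLinearMap a = (lift (k := k) v).toLinearMap a := by
  obtain ⟨t⟩ := a
  induction t with
  | of x => exact hv x
  | zero => exact h.toLinearMap.map_zero
  | add a b iha ihb => exact (h.toLinearMap.map_add _ _).trans (congrArg₂ (· + ·) iha ihb)
  | neg a iha => exact (h.toLinearMap.map_neg _).trans (congrArg (- ·) iha)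
  | smul r a iha => exact (h.toLinearMap.map_smul r _).trans (congrArg (r • ·) iha)
  | sup a b iha ihb => exact (h.map_sup' _ _).trans (congrArg₂ (· ⊔ ·) iha ihb)
  | inf a b iha ihb => exact (h.map_inf' _ _).trans (congrArg₂ (· ⊓ ·) iha ihb)

variable (k) in
/-- The canonical homomorphism `F_ℓ(I, k) → F_ℓ(J, k)` for `I ⊆ J`, which sends each generator
`i ∈ I` to the generator `i`. -/
def inclusion {J : Type*} (I : Set J) : VectorLatticeHom k (FreeVL k I) (FreeVL k J) :=
  lift fun i => of (i : J)

end FreeVL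

/-- `η_{I,J} : Id_c F_ℓ(I, k) → Id_c F_ℓ(J, k)`, the lattice homomorphism induced by `I ⊆ J`. -/
noncomputable def eta (k : Type*) [DivisionRing k] [LinearOrder k] [IsStrictOrderedRing k]
    {J : Type*} (I : Set J) : LatticeHom (Idc k (FreeVL k I)) (Idc k (FreeVL k J)) :=
  idcMap (FreeVL.inclusion k I)

/-! ### Linear functionals -/

section LinFunctional

variable {k J : Type*} [DivisionRing k]

/-! `Op⁻` is generated by the half-spaces {x | 0 < a x}, so a homomorphism to L amounts to a choice
of values s a in L that respects every inclusion between lattice words in half-spaces. Since L is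
distributive, prime filters separate its points, and the condition becomes local: for each prime
filter P and finitely many vectors a, some point x has 0 < a x exactly when s a ∈ P. This is
`Realizable`, and the theorem becomes a problem of extending a realizable assignment from the
vectors supported on I to all vectors, with every element of L as a value.

Over a finite symmetric set F of vectors, `Realizable.exists_finite_extension` adjoins one more pair
b, -b. Complete normality supplies, for each sign pattern on F, an element of L, with orthogonal
elements for incomparable patterns; the values of b and -b are joins of such elements, and convexity
of cells supplies the points. The vectors supported on I are infinitely many in general, but
Fourier–Motzkin elimination of the finitely many coordinates outside I that are involved shows that
only finitely many of them constrain the new values (`exists_finset_realizable_union`). Surjectivity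
comes from fresh coordinates: a coordinate vector outside I and outside all earlier supports can
take any value c. By countability, a sequence of finite extensions meets all these demands.

For vector lattices, a ↦ f⟨a⁺⟩ on linear elements is again realizable, by elimination of all
variables (`realizable_of_subadditive`). Extending it over `Op⁻` and composing with the cozero-set
map from `Id_c` gives g; that this map is injective is never needed. -/

theorem linFunctional_add (a b x : J →₀ k) :
    linFunctional (a + b) x = linFunctional a x + linFunctional b x :=
  Finsupp.sum_add_index' (by simp) (by intros; rw [add_mul])

theorem linFunctional_smul (c : k) (a x : J →₀ k) :
    linFunctional (c • a) x = c * linFunctional a x := by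
  unfold linFunctional
  rw [Finsupp.sum_smul_index (by simp), Finsupp.mul_sum]
  simp only [mul_assoc]

theorem linFunctional_neg (a x : J →₀ k) : linFunctional (-a) x = -linFunctional a x := by
  rw [← neg_one_smul k a, linFunctional_smul, neg_one_mul]

theorem linFunctional_apply_add (a x y : J →₀ k) :
    linFunctional a (x + y) = linFunctional a x + linFunctional a y := by
  simp [linFunctional, mul_add, Finsupp.sum_add]

theorem linFunctional_apply_zero (a : J →₀ k) : linFunctional a 0 = 0 := by
  simp [linFunctional]

theorem linFunctional_apply_op_smul (a x : J →₀ k) (c : k) :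
    linFunctional a (MulOpposite.op c • x) = linFunctional a x * c := by
  simp [linFunctional, Finsupp.sum_mul, mul_assoc]

theorem linFunctional_apply_single (a : J →₀ k) (j : J) (t : k) :
    linFunctional a (Finsupp.single j t) = a j * t := by
  classical
  unfold linFunctional
  rw [Finsupp.sum, Finset.sum_eq_single j]
  · simp
  · intro i _ hij
    simp [Finsupp.single_eq_of_ne hij]
  · intro h
    simp [Finsupp.notMem_support_iff.1 h]

theorem linFunctional_single (j : J) (c : k) (x : J →₀ k) :
    linFunctional (Finsupp.single j c) x = c * x j :=
  Finsupp.sum_single_index (by simp)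

theorem linFunctional_congr {a x y : J →₀ k} (h : ∀ j, a j ≠ 0 → x j = y j) :
    linFunctional a x = linFunctional a y :=
  Finset.sum_congr rfl fun j hj => by
    simp only [h j (Finsupp.mem_support_iff.1 hj)]

end LinFunctional

/-! ### Fourier–Motzkin elimination -/

section FourierMotzkin

theorem exists_between_divisionRing {k : Type*} [DivisionRing k] [LinearOrder k]
    [IsStrictOrderedRing k] {l r : k} (h : l < r) : ∃ t, l < t ∧ t < r := by
  have h2 : (0 : k) < 2⁻¹ := inv_pos.2 two_pos
  have hd : 0 < (r - l) * 2⁻¹ := mul_pos (sub_pos.2 h) h2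
  have e : (r - l) * 2⁻¹ + (r - l) * 2⁻¹ = r - l := by
    rw [← mul_add, ← two_mul, mul_inv_cancel₀ two_ne_zero, mul_one]
  refine ⟨l + (r - l) * 2⁻¹, lt_add_of_pos_right l hd, ?_⟩
  calc l + (r - l) * 2⁻¹ < l + (r - l) * 2⁻¹ + (r - l) * 2⁻¹ := lt_add_of_pos_right _ hd
    _ = r := by rw [add_assoc, e]; abel

/-- The strict order or the weak order, according to a Boolean flag. -/
def ltOrLe {k : Type*} [LinearOrder k] (s : Bool) (a b : k) : Prop := if s then a < b else a ≤ b

section LtOrLe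

variable {k : Type*} [LinearOrder k] {a b : k}

theorem ltOrLe.le {s : Bool} (h : ltOrLe s a b) : a ≤ b := by
  cases s
  · simpa [ltOrLe] using h
  · exact (show a < b by simpa [ltOrLe] using h).le

theorem ltOrLe_of_lt {s : Bool} (h : a < b) : ltOrLe s a b := by
  cases s
  · simpa [ltOrLe] using h.le
  · simpa [ltOrLe] using h

theorem ltOrLe_of_le_of_ne {s : Bool} (h : a ≤ b) (h' : s = true → a ≠ b) : ltOrLe s a b := by
  cases s
  · simpa [ltOrLe] using h
  · exact ltOrLe_of_lt (h.lt_of_ne (h' rfl))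

end LtOrLe

variable {k : Type*} [DivisionRing k] [LinearOrder k] [IsStrictOrderedRing k]

/-- Finitely many strict or weak, lower or upper bounds that are pairwise compatible have a common
solution. -/
theorem exists_ltOrLe_ltOrLe {α β : Type*} (A : Finset α) (B : Finset β)
    (sA : α → Bool) (sB : β → Bool) (l : α → k) (r : β → k)
    (h : ∀ a ∈ A, ∀ b ∈ B, ltOrLe (sA a || sB b) (l a) (r b)) :
    ∃ t, (∀ a ∈ A, ltOrLe (sA a) (l a) t) ∧ ∀ b ∈ B, ltOrLe (sB b) t (r b) := by
  rcases A.eq_empty_or_nonempty with rfl | hA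
  · rcases B.eq_empty_or_nonempty with rfl | hB
    · exact ⟨0, by simp, by simp⟩
    · obtain ⟨b, hb, hmin⟩ := B.exists_min_image r hB
      exact ⟨r b - 1, by simp, fun b' hb' =>
        ltOrLe_of_lt ((sub_one_lt (r b)).trans_le (hmin b' hb'))⟩
  · obtain ⟨a, ha, hmax⟩ := A.exists_max_image l hA
    rcases B.eq_empty_or_nonempty with rfl | hB
    · exact ⟨l a + 1, fun a' ha' => ltOrLe_of_lt ((hmax a' ha').trans_lt (lt_add_one _)), by simp⟩
    · obtain ⟨b, hb, hmin⟩ := B.exists_min_image r hB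
      rcases (h a ha b hb).le.lt_or_eq with hlt | heq
      · obtain ⟨t, ht, ht'⟩ := exists_between_divisionRing hlt
        exact ⟨t, fun a' ha' => ltOrLe_of_lt ((hmax a' ha').trans_lt ht),
          fun b' hb' => ltOrLe_of_lt (ht'.trans_le (hmin b' hb'))⟩
      -- The greatest lower bound equals the least upper bound, so this value is the only candidate.
      -- A strict bound cannot be attained there, since its compatibility with the opposite extreme
      -- bound is strict.
      · refine ⟨l a, fun a' ha' => ltOrLe_of_le_of_ne (hmax a' ha') ?_,
          fun b' hb' => ltOrLe_of_le_of_ne (heq.trans_le (hmin b' hb')) ?_⟩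
        · intro hs
          have := h a' ha' b hb
          simp only [hs, Bool.true_or, ltOrLe, if_true, ← heq] at this
          exact this.ne
        · intro hs
          have := h a ha b' hb'
          simp only [hs, Bool.or_true, ltOrLe, if_true] at this
          exact this.ne

variable {J : Type*}

/-- A point satisfies the strict (`true`) or weak (`false`) positivity condition given by a
functional. -/
def Satisfies (x : J →₀ k) (z : Bool × (J →₀ k)) : Prop := ltOrLe z.1 0 (linFunctional z.2 x)

/-- A set of strict and weak positivity conditions is closed under addition and under
multiplication by positive scalars. -/
structure IsConeClosed (p : Bool × (J →₀ k) → Prop) : Prop where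
  add : ∀ {z w}, p z → p w → p (z.1 || w.1, z.2 + w.2)
  smul : ∀ {c : k} {z}, 0 < c → p z → p (z.1, c • z.2)

/-- Elimination is stated for arbitrary cone-closed predicates so that one argument serves three
purposes: this predicate (derived conditions hold wherever the original ones do), vanishing of a
coordinate (no new variables appear), and membership conditions at a prime filter. -/
theorem isConeClosed_satisfies (x : J →₀ k) : IsConeClosed (Satisfies x) where
  add := by
    rintro ⟨s, a⟩ ⟨t, b⟩ h h'
    unfold Satisfies at *
    simp only [linFunctional_add] at *
    cases s <;> cases t <;> simp only [ltOrLe, Bool.or_true, Bool.or_false, if_true,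
      Bool.false_eq_true, if_false] at *
    · exact add_nonneg h h'
    · exact add_pos_of_nonneg_of_pos h h'
    · exact add_pos_of_pos_of_nonneg h h'
    · exact add_pos h h'
  smul := by
    rintro c ⟨s, a⟩ hc h
    unfold Satisfies at *
    simp only [linFunctional_smul] at *
    cases s <;> simp only [ltOrLe, if_true, Bool.false_eq_true, if_false] at *
    · exact mul_nonneg hc.le h
    · exact mul_pos hc h

/-- Elimination of one variable from a finite system of strict and weak linear inequalities. -/
theorem exists_eliminate_one (i : J) (S : Finset (Bool × (J →₀ k))) :
    ∃ S' : Finset (Bool × (J →₀ k)), (∀ z ∈ S', z.2 i = 0) ∧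
      (∀ p : Bool × (J →₀ k) → Prop, IsConeClosed p → (∀ z ∈ S, p z) → ∀ z ∈ S', p z) ∧
      ∀ x, (∀ z ∈ S', Satisfies x z) →
        ∃ y, (∀ j, j ≠ i → y j = x j) ∧ ∀ z ∈ S, Satisfies y z := by
  classical
  -- The two coefficients at `i` are normalized to 1 and -1 by left multiplication with positive
  -- scalars, so that they cancel; the sum is strict as soon as one summand is.
  let comb : Bool × (J →₀ k) → Bool × (J →₀ k) → Bool × (J →₀ k) := fun z w =>
    (z.1 || w.1, (z.2 i)⁻¹ • z.2 + (-(w.2 i))⁻¹ • w.2)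
  let Sp := S.filter fun z => 0 < z.2 i
  let Sn := S.filter fun z => z.2 i < 0
  let S0 := S.filter fun z => z.2 i = 0
  refine ⟨S0 ∪ Finset.image₂ comb Sp Sn, ?_, ?_, ?_⟩
  · intro z hz
    rcases Finset.mem_union.1 hz with hz | hz
    · exact (Finset.mem_filter.1 hz).2
    · obtain ⟨z, hzp, w, hw, rfl⟩ := Finset.mem_image₂.1 hz
      have hz' := (Finset.mem_filter.1 hzp).2
      have hw' := (Finset.mem_filter.1 hw).2
      simp [comb, inv_neg, inv_mul_cancel₀ hz'.ne', inv_mul_cancel₀ hw'.ne]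
  · intro p hp hS z hz
    rcases Finset.mem_union.1 hz with hz | hz
    · exact hS z (Finset.mem_filter.1 hz).1
    · obtain ⟨z, hzp, w, hw, rfl⟩ := Finset.mem_image₂.1 hz
      obtain ⟨hzS, hz'⟩ := Finset.mem_filter.1 hzp
      obtain ⟨hwS, hw'⟩ := Finset.mem_filter.1 hw
      exact hp.add (hp.smul (inv_pos.2 hz') (hS z hzS))
        (hp.smul (inv_pos.2 (neg_pos.2 hw')) (hS w hwS))
  · intro x hx
    obtain ⟨t, hl, hr⟩ := exists_ltOrLe_ltOrLe Sp Sn (fun z => z.1) (fun z => z.1)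
      (fun z => -((z.2 i)⁻¹ * linFunctional z.2 x))
      (fun w => (-(w.2 i))⁻¹ * linFunctional w.2 x) (by
        intro z hz w hw
        have := hx _ (Finset.mem_union_right _ (Finset.mem_image₂_of_mem hz hw))
        simp only [Satisfies, comb, linFunctional_add, linFunctional_smul] at this
        unfold ltOrLe at *
        split_ifs at * with hs
        · exact neg_lt_iff_pos_add'.2 (by simpa [add_comm] using this)
        · exact neg_le_iff_add_nonneg'.2 (by simpa [add_comm] using this))
    refine ⟨x + Finsupp.single i t, fun j hj => by simp [Finsupp.single_eq_of_ne hj], ?_⟩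
    intro z hz
    simp only [Satisfies, linFunctional_apply_add, linFunctional_apply_single]
    rcases lt_trichotomy (z.2 i) 0 with h | h | h
    · have := hr z (Finset.mem_filter.2 ⟨hz, h⟩)
      have e : linFunctional z.2 x + z.2 i * t
          = -(z.2 i) * ((-(z.2 i))⁻¹ * linFunctional z.2 x - t) := by
        rw [mul_sub, mul_inv_cancel_left₀ (neg_ne_zero.2 h.ne)]; simp
      rw [e]
      unfold ltOrLe at *
      split_ifs at * with hs
      · exact mul_pos (neg_pos.2 h) (sub_pos.2 this)
      · exact mul_nonneg (neg_pos.2 h).le (sub_nonneg.2 this)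
    · rw [h, zero_mul, add_zero]
      exact hx z (Finset.mem_union_left _ (Finset.mem_filter.2 ⟨hz, h⟩))
    · have := hl z (Finset.mem_filter.2 ⟨hz, h⟩)
      have e : linFunctional z.2 x + z.2 i * t
          = z.2 i * (t - -((z.2 i)⁻¹ * linFunctional z.2 x)) := by
        rw [sub_neg_eq_add, mul_add, mul_inv_cancel_left₀ h.ne', add_comm]
      rw [e]
      unfold ltOrLe at *
      split_ifs at * with hs
      · exact mul_pos h (sub_pos.2 this)
      · exact mul_nonneg h.le (sub_nonneg.2 this)

/-- Elimination of finitely many variables from a finite system of strict and weak linear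
inequalities. -/
theorem exists_eliminate (T : Finset J) (S : Finset (Bool × (J →₀ k))) :
    ∃ S' : Finset (Bool × (J →₀ k)), (∀ z ∈ S', ∀ i ∈ T, z.2 i = 0) ∧
      (∀ p : Bool × (J →₀ k) → Prop, IsConeClosed p → (∀ z ∈ S, p z) → ∀ z ∈ S', p z) ∧
      ∀ x, (∀ z ∈ S', Satisfies x z) →
        ∃ y, (∀ j, j ∉ T → y j = x j) ∧ ∀ z ∈ S, Satisfies y z := by
  classical
  induction T using Finset.induction_on with
  | empty => exact ⟨S, by simp, fun _ _ h => h, fun x hx => ⟨x, by simp, hx⟩⟩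
  | insert i T _ ih =>
    obtain ⟨S₁, h0, hp, hx⟩ := ih
    obtain ⟨S₂, h0', hp', hx'⟩ := exists_eliminate_one i S₁
    refine ⟨S₂, ?_, fun p hc h => hp' p hc (hp p hc h), ?_⟩
    · intro z hz j hj
      rcases Finset.mem_insert.1 hj with rfl | hj
      · exact h0' z hz
      -- Vanishing at an already eliminated coordinate is cone-closed, so it survives the
      -- elimination of `i`.
      · refine hp' (fun z => z.2 j = 0) ⟨?_, ?_⟩ (fun z hz => h0 z hz j hj) z hz
        · intro z w hz hw
          simp [hz, hw]
        · intro c z _ hz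
          simp [hz]
    · intro x hxS
      obtain ⟨y, hy, hyS⟩ := hx' x hxS
      obtain ⟨y', hy', hyS'⟩ := hx y hyS
      refine ⟨y', fun j hj => ?_, hyS'⟩
      rw [Finset.mem_insert, not_or] at hj
      rw [hy' j hj.2, hy j hj.1]

end FourierMotzkin

/-! ### Prime filters and realizable assignments -/

/-- A possibly empty prime filter of a lattice with least element, given by its indicator. -/
structure PrimeIndicator (L : Type*) [Lattice L] [OrderBot L] where
  /-- Membership in the prime filter. -/
  mem : L → Prop
  mem_sup : ∀ {a b : L}, mem (a ⊔ b) ↔ mem a ∨ mem b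
  mem_inf : ∀ {a b : L}, mem (a ⊓ b) ↔ mem a ∧ mem b
  not_mem_bot : ¬ mem ⊥

namespace PrimeIndicator

variable {L : Type*}

theorem mem_of_le [Lattice L] [OrderBot L] (P : PrimeIndicator L) {a b : L} (h : a ≤ b)
    (ha : P.mem a) : P.mem b := by
  rw [← sup_eq_right.2 h, P.mem_sup]
  exact Or.inl ha

theorem mem_finsetSup [Lattice L] [OrderBot L] (P : PrimeIndicator L) {α : Type*} {A : Finset α}
    {f : α → L} : P.mem (A.sup f) ↔ ∃ a ∈ A, P.mem (f a) := by
  classical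
  induction A using Finset.induction_on with
  | empty => simp [P.not_mem_bot]
  | insert a A _ ih => simp [Finset.sup_insert, P.mem_sup, ih]

theorem mem_finsetInf' [Lattice L] [OrderBot L] (P : PrimeIndicator L) {α : Type*} {A : Finset α}
    (hA : A.Nonempty) {f : α → L} : P.mem (A.inf' hA f) ↔ ∀ a ∈ A, P.mem (f a) := by
  classical
  induction hA using Finset.Nonempty.cons_induction with
  | singleton a => simp
  | cons a A h hA ih => rw [Finset.inf'_cons hA, P.mem_inf, ih, Finset.forall_mem_cons]

/-- The prime ideal theorem separates the filter generated by `a` from the ideal generated by `b`;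
the indicator is that of the complement of the prime ideal. -/
theorem exists_of_not_le [DistribLattice L] [OrderBot L] {a b : L} (h : ¬ a ≤ b) :
    ∃ P : PrimeIndicator L, P.mem a ∧ ¬ P.mem b := by
  obtain ⟨Q, hQ, hbQ, hd⟩ := DistribLattice.prime_ideal_of_disjoint_filter_ideal
    (F := Order.PFilter.principal a) (I := Order.Ideal.principal b) (by
      rw [Set.disjoint_left]
      intro x hx hx'
      exact h (le_trans (Order.PFilter.mem_principal.1 hx) (Order.Ideal.mem_principal.1 hx')))
  refine ⟨⟨fun x => x ∉ Q, ?_, ?_, ?_⟩, ?_, ?_⟩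
  · intro x y
    rw [Order.Ideal.sup_mem_iff, not_and_or]
  · intro x y
    constructor
    · intro hxy
      exact ⟨fun hx => hxy (Q.lower inf_le_left hx), fun hy => hxy (Q.lower inf_le_right hy)⟩
    · rintro ⟨hx, hy⟩ hxy
      exact (hQ.mem_or_mem hxy).elim hx hy
  · exact fun hb => hb Q.bot_mem
  · exact fun ha => Set.disjoint_left.1 hd (Order.PFilter.mem_principal.2 le_rfl) ha
  · exact fun hb => hb (hbQ (Order.Ideal.mem_principal.2 le_rfl))

end PrimeIndicator

section Realizable

variable {k : Type*} [DivisionRing k] [LinearOrder k]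
  {J : Type*} {L : Type*} [DistribLattice L] [OrderBot L]

/-- An assignment of elements of `L` to the open half-spaces `{x | 0 < a x}`, for `a ∈ F`, is
realizable if, locally at every prime filter of `L`, finitely many of those half-spaces have the
membership pattern of some point. -/
def Realizable (F : Set (J →₀ k)) (s : (J →₀ k) → L) : Prop :=
  ∀ P : PrimeIndicator L, ∀ A : Finset (J →₀ k), (A : Set (J →₀ k)) ⊆ F →
    ∃ x : J →₀ k, ∀ a ∈ A, 0 < linFunctional a x ↔ P.mem (s a)

theorem Realizable.mono {F G : Set (J →₀ k)} {s : (J →₀ k) → L} (h : Realizable G s)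
    (hFG : F ⊆ G) : Realizable F s :=
  fun P A hA => h P A (hA.trans hFG)

theorem Realizable.congr {F : Set (J →₀ k)} {s t : (J →₀ k) → L} (h : Realizable F s)
    (hst : ∀ a ∈ F, t a = s a) : Realizable F t := by
  intro P A hA
  obtain ⟨x, hx⟩ := h P A hA
  exact ⟨x, fun a ha => by rw [hst a (hA ha), hx a ha]⟩

/-! ### From realizable assignments to homomorphisms -/

/-- The sublattice of `Set (J →₀ k) × L` generated by the graph of an assignment. -/
def assignmentGraph (s : (J →₀ k) → L) : Set (Set (J →₀ k) × L) :=
  latticeClosure (Set.range fun a => ({x | 0 < linFunctional a x}, s a))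

/-- A lattice word involves finitely many generators. If a point and a prime filter agree on these,
they agree on the whole word, by primeness. -/
theorem exists_finset_of_mem_assignmentGraph {s : (J →₀ k) → L} {z : Set (J →₀ k) × L}
    (hz : z ∈ assignmentGraph s) : ∃ A : Finset (J →₀ k), ∀ (P : PrimeIndicator L) (x : J →₀ k),
      (∀ a ∈ A, 0 < linFunctional a x ↔ P.mem (s a)) → (x ∈ z.1 ↔ P.mem z.2) := by
  classical
  unfold assignmentGraph at hz
  induction hz using latticeClosure_sup_inf_induction with
  | mem z hz =>
    obtain ⟨a, rfl⟩ := hz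
    exact ⟨{a}, fun P x h => h a (Finset.mem_singleton_self a)⟩
  | sup z _ w _ ihz ihw =>
    obtain ⟨A, hA⟩ := ihz
    obtain ⟨B, hB⟩ := ihw
    refine ⟨A ∪ B, fun P x h => ?_⟩
    rw [Prod.snd_sup, P.mem_sup, ← hA P x fun a ha => h a (Finset.mem_union_left _ ha),
      ← hB P x fun a ha => h a (Finset.mem_union_right _ ha)]
    rfl
  | inf z _ w _ ihz ihw =>
    obtain ⟨A, hA⟩ := ihz
    obtain ⟨B, hB⟩ := ihw
    refine ⟨A ∪ B, fun P x h => ?_⟩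
    rw [Prod.snd_inf, P.mem_inf, ← hA P x fun a ha => h a (Finset.mem_union_left _ ha),
      ← hB P x fun a ha => h a (Finset.mem_union_right _ ha)]
    rfl

/-- A prime filter containing `z.2` but not `w.2` would be matched by a point of `z.1` outside
`w.1`. Used in both directions, this makes the generated sublattice the graph of a function. -/
theorem Realizable.le_of_subset {s : (J →₀ k) → L} (hs : Realizable Set.univ s)
    {z w : Set (J →₀ k) × L} (hz : z ∈ assignmentGraph s) (hw : w ∈ assignmentGraph s)
    (h : z.1 ⊆ w.1) : z.2 ≤ w.2 := by
  classical
  by_contra hle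
  obtain ⟨P, hPz, hPw⟩ := PrimeIndicator.exists_of_not_le hle
  obtain ⟨A, hA⟩ := exists_finset_of_mem_assignmentGraph hz
  obtain ⟨B, hB⟩ := exists_finset_of_mem_assignmentGraph hw
  obtain ⟨x, hx⟩ := hs P (A ∪ B) (Set.subset_univ _)
  have hxz := (hA P x fun a ha => hx a (Finset.mem_union_left _ ha)).2 hPz
  exact hPw ((hB P x fun a ha => hx a (Finset.mem_union_right _ ha)).1 (h hxz))

end Realizable

section OpHom

set_option linter.unusedSectionVars false

variable {k : Type*} [DivisionRing k] [LinearOrder k] [IsStrictOrderedRing k]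
  {J : Type*} {L : Type*} [DistribLattice L] [OrderBot L]

/-- The open half-space `{x | 0 < a x}` as an element of `Op⁻(k^(J), k^(J))`. -/
def halfSpace (a : J →₀ k) : OpSpace k J :=
  ⟨{x | 0 < linFunctional a x}, subset_latticeClosure ⟨_, ⟨a, rfl⟩, Or.inl rfl⟩⟩

theorem halfSpace_generators (U : Set (J →₀ k))
    (hU : ∃ f ∈ Set.range (linFunctional (k := k) (I := J)),
      U = {x | 0 < f x} ∨ U = {x | f x < 0}) :
    ∃ a : J →₀ k, U = {x | 0 < linFunctional a x} := by
  obtain ⟨_, ⟨a, rfl⟩, rfl | rfl⟩ := hU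
  · exact ⟨a, rfl⟩
  · exact ⟨-a, by simp only [linFunctional_neg, Left.neg_pos_iff]⟩

theorem OpSpace.induction {p : OpSpace k J → Prop} (half : ∀ a, p (halfSpace a))
    (sup : ∀ X Y, p X → p Y → p (X ⊔ Y)) (inf : ∀ X Y, p X → p Y → p (X ⊓ Y))
    (X : OpSpace k J) : p X := by
  obtain ⟨U, hU⟩ := X
  refine latticeClosure_sup_inf_induction (fun U hU => p ⟨U, hU⟩) ?_ ?_ ?_ hU
  · intro U hU
    obtain ⟨a, rfl⟩ := halfSpace_generators U hU
    exact half a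
  · exact fun U hU V hV h h' => sup ⟨U, hU⟩ ⟨V, hV⟩ h h'
  · exact fun U hU V hV h h' => inf ⟨U, hU⟩ ⟨V, hV⟩ h h'

theorem exists_mem_assignmentGraph (s : (J →₀ k) → L) (X : OpSpace k J) :
    ∃ l, ((X : Set (J →₀ k)), l) ∈ assignmentGraph s := by
  induction X using OpSpace.induction with
  | half a => exact ⟨s a, subset_latticeClosure ⟨a, rfl⟩⟩
  | sup X Y hX hY =>
    obtain ⟨l, hl⟩ := hX
    obtain ⟨m, hm⟩ := hY
    exact ⟨l ⊔ m, isSublattice_latticeClosure.supClosed hl hm⟩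
  | inf X Y hX hY =>
    obtain ⟨l, hl⟩ := hX
    obtain ⟨m, hm⟩ := hY
    exact ⟨l ⊓ m, isSublattice_latticeClosure.infClosed hl hm⟩

/-- A realizable assignment extends to a lattice homomorphism on `Op⁻(k^(J), k^(J))`. -/
theorem Realizable.exists_latticeHom {s : (J →₀ k) → L} (hs : Realizable Set.univ s) :
    ∃ g : LatticeHom (OpSpace k J) L, ∀ a, g (halfSpace a) = s a := by
  choose g hg using exists_mem_assignmentGraph (k := k) s
  have key : ∀ (X : OpSpace k J) l, ((X : Set (J →₀ k)), l) ∈ assignmentGraph s →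
      g X = l := fun X l hl =>
    le_antisymm (hs.le_of_subset (hg X) hl subset_rfl) (hs.le_of_subset hl (hg X) subset_rfl)
  exact ⟨⟨⟨g, fun X Y => key _ _ (isSublattice_latticeClosure.supClosed (hg X) (hg Y))⟩,
    fun X Y => key _ _ (isSublattice_latticeClosure.infClosed (hg X) (hg Y))⟩,
    fun a => key _ _ (subset_latticeClosure ⟨a, rfl⟩)⟩

/-- A lattice homomorphism on `Op⁻(k^(J), k^(J))` that preserves `⊥` is given by a realizable
assignment. -/
theorem realizable_of_latticeHom (f : LatticeHom (OpSpace k J) L) (hf : f ⊥ = ⊥) :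
    Realizable Set.univ fun a => f (halfSpace a) := by
  classical
  intro P A _
  by_contra! hx
  let A₁ := A.filter fun a => P.mem (f (halfSpace a))
  let A₀ := A.filter fun a => ¬ P.mem (f (halfSpace a))
  -- If no point has the pattern of `P`, the intersection of the half-spaces from `A₁` is covered by
  -- those from `A₀`.
  have cover : ∀ x : J →₀ k, (∀ a ∈ A₁, 0 < linFunctional a x) →
      ∃ a ∈ A₀, 0 < linFunctional a x := by
    intro x h1
    obtain ⟨a, ha, h⟩ := hx x
    rcases h with h | h
    · exact ⟨a, Finset.mem_filter.2 ⟨ha, h.2⟩, h.1⟩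
    · exact absurd (h1 a (Finset.mem_filter.2 ⟨ha, h.2⟩)) (not_lt.2 h.1)
  -- There may be no top element to serve as an empty meet. The empty case is refuted by the origin,
  -- which lies in no open half-space.
  rcases A₁.eq_empty_or_nonempty with hA | hA
  · obtain ⟨a, _, ha⟩ := cover 0 (by simp [hA])
    simp [linFunctional_apply_zero] at ha
  · have hsub : A₁.inf' hA halfSpace ≤ A₀.sup (halfSpace (k := k)) := by
      intro x hx'
      have hx1 : ∀ a ∈ A₁, 0 < linFunctional a x := fun a ha =>
        (Finset.inf'_le halfSpace ha : A₁.inf' hA halfSpace ≤ halfSpace a) hx'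
      obtain ⟨a, ha, hpos⟩ := cover x hx1
      exact (Finset.le_sup ha : halfSpace a ≤ A₀.sup (halfSpace (k := k))) hpos
    -- The preimage of `P` under `f` may be empty, which prime indicators allow.
    let Q : PrimeIndicator (OpSpace k J) :=
      ⟨fun X => P.mem (f X), by simp [P.mem_sup], by simp [P.mem_inf],
        by simpa [hf] using P.not_mem_bot⟩
    have h1 : Q.mem (A₁.inf' hA halfSpace) :=
      (Q.mem_finsetInf' hA).2 fun a ha => (Finset.mem_filter.1 ha).2
    obtain ⟨a, ha, h⟩ := Q.mem_finsetSup.1 (Q.mem_of_le hsub h1)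
    exact (Finset.mem_filter.1 ha).2 h

end OpHom

/-! ### Extending a finite realizable assignment by one half-space -/

/-- The witnesses for (a, b) and for (b, a) are unrelated. Taking the meet of the two bounds on a ∖
b that they provide gives differences that are orthogonal in the two orders. -/
theorem CompletelyNormal.exists_difference {L : Type*} [DistribLattice L] [OrderBot L]
    (hL : CompletelyNormal L) :
    ∃ c : L → L → L, (∀ a b, a ≤ b ⊔ c a b) ∧ ∀ a b, c a b ⊓ c b a = ⊥ := by
  choose u v hu hv huv using hL
  refine ⟨fun a b => u a b ⊓ v b a, fun a b => ?_, fun a b => ?_⟩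
  · rw [sup_inf_left]
    exact le_inf ((hu a b).trans_eq (sup_comm _ _)) (hv b a)
  · refine le_bot_iff.1 (le_trans ?_ (huv a b).le)
    exact le_inf (inf_le_left.trans inf_le_left) (inf_le_right.trans inf_le_right)

/-- For a finite family in a completely normal lattice, every membership pattern `σ` is witnessed
by an element `δ σ`, and those elements are orthogonal for incomparable patterns. -/
theorem CompletelyNormal.exists_pattern {L : Type*} [DistribLattice L] [OrderBot L]
    (hL : CompletelyNormal L) {α : Type*} [DecidableEq α] (F : Finset α) (s : α → L) :
    ∃ δ : Finset α → L,
      (∀ (P : PrimeIndicator L) σ, P.mem (δ σ) → ∀ a ∈ σ, P.mem (s a)) ∧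
      (∀ (P : PrimeIndicator L), ∀ σ ⊆ F, ∀ τ ⊆ F, P.mem (δ σ) → P.mem (δ τ) → σ ⊆ τ ∨ τ ⊆ σ) ∧
      ∀ (P : PrimeIndicator L), ∀ σ ⊆ F, σ.Nonempty → (∀ a ∈ F, a ∈ σ ↔ P.mem (s a)) →
        P.mem (δ σ) := by
  obtain ⟨c, hc, hc'⟩ := hL.exists_difference
  -- The empty pattern gets `⊥` for want of a top element; hence the nonemptiness condition in the
  -- last clause.
  let f : Finset α → L := fun σ => if h : σ.Nonempty then σ.inf' h s else ⊥
  have hf : ∀ (P : PrimeIndicator L) σ, P.mem (f σ) ↔ σ.Nonempty ∧ ∀ a ∈ σ, P.mem (s a) := by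
    intro P σ
    by_cases h : σ.Nonempty
    · simp only [f, h, dif_pos, P.mem_finsetInf' h, true_and]
    · simp only [f, h, dif_neg, not_false_iff, P.not_mem_bot, false_and]
  have hne : F.powerset.Nonempty := ⟨∅, Finset.empty_mem_powerset F⟩
  -- `δ σ` is the part of `f σ` left after removing `f τ` for every τ not contained in σ. For
  -- incomparable σ and τ, it lies below the difference in one order and `δ τ` below the difference
  -- in the other.
  let δ : Finset α → L := fun σ =>
    F.powerset.inf' hne fun τ => if τ ⊆ σ then f σ else f σ ⊓ c (f σ) (f τ)
  have hδ : ∀ (P : PrimeIndicator L) σ, P.mem (δ σ) ↔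
      P.mem (f σ) ∧ ∀ τ ⊆ F, ¬ τ ⊆ σ → P.mem (c (f σ) (f τ)) := by
    intro P σ
    simp only [δ, P.mem_finsetInf' hne, Finset.mem_powerset]
    constructor
    · intro h
      refine ⟨by simpa using h ∅ (Finset.empty_subset F), fun τ hτ hτσ => ?_⟩
      have := h τ hτ
      rw [if_neg hτσ, P.mem_inf] at this
      exact this.2
    · rintro ⟨h, h'⟩ τ hτ
      split_ifs with hτσ
      · exact h
      · exact P.mem_inf.2 ⟨h, h' τ hτ hτσ⟩
  refine ⟨δ, fun P σ h => ((hf P σ).1 ((hδ P σ).1 h).1).2, ?_, ?_⟩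
  · intro P σ hσ τ hτ h h'
    by_contra! hne
    have h1 := ((hδ P σ).1 h).2 τ hτ hne.2
    have h2 := ((hδ P τ).1 h').2 σ hσ hne.1
    exact P.not_mem_bot (hc' (f σ) (f τ) ▸ P.mem_inf.2 ⟨h1, h2⟩)
  · intro P σ hσ hσne hσP
    have hfσ : P.mem (f σ) := (hf P σ).2 ⟨hσne, fun a ha => (hσP a (hσ ha)).1 ha⟩
    refine (hδ P σ).2 ⟨hfσ, fun τ hτ hτσ => ?_⟩
    refine (P.mem_sup.1 (P.mem_of_le (hc (f σ) (f τ)) hfσ)).resolve_left fun hfτ => hτσ ?_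
    exact fun a ha => (hσP a (hτ ha)).2 (((hf P τ).1 hfτ).2 a ha)

section FiniteExtension

variable {k : Type*} [DivisionRing k] [LinearOrder k] [IsStrictOrderedRing k] {J : Type*}

/-- A point of an open cell has a translate in any given cell of its star where a given functional
keeps its sign. -/
theorem exists_mem_star_pos {F : Finset (J →₀ k)} (hF : ∀ a ∈ F, -a ∈ F) {b x y : J →₀ k}
    (hyx : ∀ a ∈ F, 0 < linFunctional a y → 0 < linFunctional a x) (hb : 0 < linFunctional b y) :
    ∃ z, (∀ a ∈ F, 0 < linFunctional a z ↔ 0 < linFunctional a x) ∧ 0 < linFunctional b z := by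
  -- A small displacement from y in the direction of x keeps `b` positive.
  obtain ⟨ε, hε, hbε⟩ : ∃ ε : k, 0 < ε ∧ 0 < linFunctional b y + linFunctional b x * ε := by
    rcases le_or_gt 0 (linFunctional b x) with h | h
    · exact ⟨1, one_pos, by rw [mul_one]; exact add_pos_of_pos_of_nonneg hb h⟩
    · obtain ⟨c, hc, hcb⟩ := exists_between_divisionRing hb
      refine ⟨(-linFunctional b x)⁻¹ * c, mul_pos (inv_pos.2 (neg_pos.2 h)) hc, ?_⟩
      rw [inv_neg, neg_mul, mul_neg, mul_inv_cancel_left₀ h.ne, ← sub_eq_add_neg]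
      exact sub_pos.2 hcb
  refine ⟨y + MulOpposite.op ε • x, fun a ha => ?_, ?_⟩
  · rw [linFunctional_apply_add, linFunctional_apply_op_smul]
    constructor
    · intro h
      by_contra! hx
      have hy : linFunctional a y ≤ 0 := not_lt.1 fun hy => hx.not_gt (hyx a ha hy)
      exact h.not_ge (add_nonpos hy (mul_nonpos_of_nonpos_of_nonneg hx hε.le))
    · intro h
      -- Here a y ≥ 0: otherwise -a, which lies in `F`, would be positive at y and hence at x.
      refine add_pos_of_nonneg_of_pos ?_ (mul_pos h hε)
      by_contra! hy
      have := hyx (-a) (hF a ha) (by rw [linFunctional_neg]; exact neg_pos.2 hy)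
      rw [linFunctional_neg] at this
      exact h.not_gt (neg_pos.1 this)
  · rwa [linFunctional_apply_add, linFunctional_apply_op_smul]

/-- Cells are closed under positive right combinations; the weights bring the values of `b` at x and
y to -1 and 1. -/
theorem exists_mem_cell_eq_zero {F : Finset (J →₀ k)} {b x y : J →₀ k}
    (hyx : ∀ a ∈ F, 0 < linFunctional a y ↔ 0 < linFunctional a x)
    (hx : linFunctional b x ≤ 0) (hy : 0 ≤ linFunctional b y) :
    ∃ z, (∀ a ∈ F, 0 < linFunctional a z ↔ 0 < linFunctional a x) ∧ linFunctional b z = 0 := by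
  rcases hx.eq_or_lt with hx | hx
  · exact ⟨x, fun _ _ => Iff.rfl, hx⟩
  rcases hy.eq_or_lt with hy | hy
  · exact ⟨y, hyx, hy.symm⟩
  have hx' : 0 < (-linFunctional b x)⁻¹ := inv_pos.2 (neg_pos.2 hx)
  have hy' : 0 < (linFunctional b y)⁻¹ := inv_pos.2 hy
  refine ⟨MulOpposite.op (-linFunctional b x)⁻¹ • x + MulOpposite.op (linFunctional b y)⁻¹ • y,
    fun a ha => ?_, ?_⟩
  · rw [linFunctional_apply_add, linFunctional_apply_op_smul, linFunctional_apply_op_smul]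
    by_cases h : 0 < linFunctional a x
    · exact iff_of_true (add_pos (mul_pos h hx') (mul_pos ((hyx a ha).2 h) hy')) h
    · have h' : ¬ 0 < linFunctional a y := fun h' => h ((hyx a ha).1 h')
      exact iff_of_false (not_lt.2 (add_nonpos
        (mul_nonpos_of_nonpos_of_nonneg (not_lt.1 h) hx'.le)
        (mul_nonpos_of_nonpos_of_nonneg (not_lt.1 h') hy'.le))) h
  · rw [linFunctional_apply_add, linFunctional_apply_op_smul, linFunctional_apply_op_smul,
      inv_neg, mul_neg, mul_inv_cancel₀ hx.ne, mul_inv_cancel₀ hy.ne', neg_add_cancel]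

variable {L : Type*} [DistribLattice L] [OrderBot L]

/-- The value of b is the join of `δ σ` over the cells σ where b is positive throughout, and
similarly for -b. Let x realize the pattern of P. If P contains `δ σ`, then σ is contained in the
pattern of x, and a point of σ pushed slightly towards x lands in the cell of x with b still
positive. If P contains neither join, then b is neither positive nor negative throughout the cell of
x, so it vanishes somewhere on it. -/
theorem Realizable.exists_finite_extension (hL : CompletelyNormal L) {F : Finset (J →₀ k)}
    (hF : ∀ a ∈ F, -a ∈ F) {s : (J →₀ k) → L} (hs : Realizable (F : Set (J →₀ k)) s)
    (b : J →₀ k) : ∃ u v : L, ∀ P : PrimeIndicator L, ∃ x : J →₀ k,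
      (∀ a ∈ F, 0 < linFunctional a x ↔ P.mem (s a)) ∧
      (0 < linFunctional b x ↔ P.mem u) ∧ (linFunctional b x < 0 ↔ P.mem v) := by
  classical
  obtain ⟨δ, hδ, hδ', hδ''⟩ := hL.exists_pattern F s
  let cell : (J →₀ k) → Finset (J →₀ k) := fun x => F.filter fun a => 0 < linFunctional a x
  have cell_sub : ∀ x, cell x ⊆ F := fun x => Finset.filter_subset _ F
  have star : ∀ {x y}, cell y ⊆ cell x → ∀ a ∈ F, 0 < linFunctional a y → 0 < linFunctional a x :=
    fun h a ha hy => (Finset.mem_filter.1 (h (Finset.mem_filter.2 ⟨ha, hy⟩))).2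
  -- The existence clause discards patterns of no point, for which positivity would hold vacuously.
  let T : (J →₀ k) → Finset (Finset (J →₀ k)) := fun b => F.powerset.filter fun σ =>
    ∃ y, cell y = σ ∧ ∀ y', cell y' = σ → 0 < linFunctional b y'
  have memT : ∀ {b σ}, σ ∈ T b → ∃ y, cell y = σ ∧ ∀ y', cell y' = σ → 0 < linFunctional b y' :=
    fun h => (Finset.mem_filter.1 h).2
  have cell_congr : ∀ {x y}, (∀ a ∈ F, 0 < linFunctional a x ↔ 0 < linFunctional a y) →
      cell x = cell y := fun h => Finset.filter_congr h
  have disj : ∀ {b : J →₀ k} {σ τ}, σ ∈ T b → τ ∈ T (-b) → ¬ σ ⊆ τ := by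
    intro b σ τ hσ hτ hsub
    obtain ⟨y, rfl, hy⟩ := memT hσ
    obtain ⟨x, rfl, hx⟩ := memT hτ
    obtain ⟨z, hz, hbz⟩ := exists_mem_star_pos hF (star hsub) (hy y rfl)
    have := hx z (cell_congr hz)
    rw [linFunctional_neg] at this
    exact hbz.not_gt (neg_pos.1 this)
  -- Two patterns witnessed at the same `P` are comparable, and comparable cells cannot carry
  -- opposite constant signs of `b`, by `disj`.
  have orth : ∀ (P : PrimeIndicator L) (b : J →₀ k), P.mem ((T b).sup δ) →
      ¬ P.mem ((T (-b)).sup δ) := by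
    intro P b h h'
    obtain ⟨σ, hσ, hPσ⟩ := P.mem_finsetSup.1 h
    obtain ⟨τ, hτ, hPτ⟩ := P.mem_finsetSup.1 h'
    rcases hδ' P σ (Finset.mem_powerset.1 (Finset.mem_filter.1 hσ).1) τ
      (Finset.mem_powerset.1 (Finset.mem_filter.1 hτ).1) hPσ hPτ with hsub | hsub
    · exact disj hσ hτ hsub
    · exact disj (b := -b) hτ (by rwa [neg_neg]) hsub
  refine ⟨(T b).sup δ, (T (-b)).sup δ, fun P => ?_⟩
  obtain ⟨x, hx⟩ := hs P F subset_rfl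
  have move : ∀ b : J →₀ k, P.mem ((T b).sup δ) →
      ∃ z, (∀ a ∈ F, 0 < linFunctional a z ↔ P.mem (s a)) ∧ 0 < linFunctional b z := by
    intro b h
    obtain ⟨σ, hσ, hPσ⟩ := P.mem_finsetSup.1 h
    obtain ⟨y, rfl, hy⟩ := memT hσ
    obtain ⟨z, hz, hbz⟩ := exists_mem_star_pos hF (b := b) (x := x) (y := y)
      (fun a ha hay => (hx a ha).2 (hδ P _ hPσ a (Finset.mem_filter.2 ⟨ha, hay⟩))) (hy y rfl)
    exact ⟨z, fun a ha => (hz a ha).trans (hx a ha), hbz⟩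
  have stay : ∀ b : J →₀ k, ¬ P.mem ((T b).sup δ) →
      ∃ z, (∀ a ∈ F, 0 < linFunctional a z ↔ 0 < linFunctional a x) ∧ linFunctional b z ≤ 0 := by
    intro b h
    by_contra! hpos
    have hpos' : ∀ y', cell y' = cell x → 0 < linFunctional b y' := by
      intro y' hy'
      refine hpos y' fun a ha => ⟨star hy'.le a ha, star hy'.ge a ha⟩
    refine h (P.mem_finsetSup.2 ⟨cell x, Finset.mem_filter.2
      ⟨Finset.mem_powerset.2 (cell_sub x), x, rfl, hpos'⟩,
      hδ'' P _ (cell_sub x) ?_ fun a ha => ?_⟩)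
    -- The empty pattern is that of the origin, where `b` is not positive.
    · by_contra hne
      rw [Finset.not_nonempty_iff_eq_empty] at hne
      have := hpos' 0 (by rw [hne]; simp [cell, linFunctional_apply_zero])
      simp [linFunctional_apply_zero] at this
    · rw [← hx a ha]
      simp [cell, ha]
  by_cases hu : P.mem ((T b).sup δ)
  · obtain ⟨z, hz, hbz⟩ := move b hu
    exact ⟨z, hz, iff_of_true hbz hu, iff_of_false hbz.not_gt (orth P b hu)⟩
  by_cases hv : P.mem ((T (-b)).sup δ)
  · obtain ⟨z, hz, hbz⟩ := move (-b) hv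
    rw [linFunctional_neg, neg_pos] at hbz
    exact ⟨z, hz, iff_of_false hbz.not_gt hu, iff_of_true hbz hv⟩
  obtain ⟨y, hy, hby⟩ := stay b hu
  obtain ⟨z, hz, hbz⟩ := stay (-b) hv
  rw [linFunctional_neg, neg_nonpos] at hbz
  obtain ⟨w, hw, hbw⟩ := exists_mem_cell_eq_zero
    (fun a ha => (hz a ha).trans (hy a ha).symm) hby hbz
  refine ⟨w, fun a ha => (hw a ha).trans ((hy a ha).trans (hx a ha)), ?_, ?_⟩
  · exact iff_of_false (by simp [hbw]) hu
  · exact iff_of_false (by simp [hbw]) hv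

end FiniteExtension

/-! ### Extending realizable assignments -/

section Extension

set_option linter.unusedSectionVars false

variable {k : Type*} [DivisionRing k] [LinearOrder k] [IsStrictOrderedRing k]
  {J : Type*} {L : Type*} [DistribLattice L] [OrderBot L]

variable (k) in
/-- The vectors of `k^(J)` that are supported on `I`. -/
def supportedOn (I : Set J) : Set (J →₀ k) := {a | ∀ j, j ∉ I → a j = 0}

/-- Over the vectors supported on `I`, realizability of finitely many further values can be tested
on a finite set. -/
theorem exists_finset_realizable_union (I : Set J) (G : Finset (J →₀ k)) :
    ∃ W : Finset (J →₀ k), (W : Set (J →₀ k)) ⊆ supportedOn k I ∧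
      ∀ s : (J →₀ k) → L, Realizable (supportedOn k I) s →
        Realizable ((G : Set (J →₀ k)) ∪ W) s → Realizable (supportedOn k I ∪ G) s := by
  classical
  let T : Finset J := (G.biUnion Finsupp.support).filter (· ∉ I)
  have hT : ∀ a ∈ G, ∀ j, j ∉ I → j ∉ T → a j = 0 := by
    intro a ha j hj hjT
    by_contra hne
    exact hjT (Finset.mem_filter.2
      ⟨Finset.mem_biUnion.2 ⟨a, ha, Finsupp.mem_support_iff.2 hne⟩, hj⟩)
  -- The system expressing that `σ` is the pattern of a point on `G`. Eliminating `T` leaves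
  -- conditions on vectors supported on `I`; those for all `σ` make up `W`, independently of `s`.
  let S : Finset (J →₀ k) → Finset (Bool × (J →₀ k)) := fun σ =>
    G.image fun a => if a ∈ σ then (true, a) else (false, -a)
  choose S' hS0 hScone hSsol using fun σ => exists_eliminate T (S σ)
  have hS'supp : ∀ σ, ∀ z ∈ S' σ, z.2 ∈ supportedOn k I := by
    intro σ z hz j hj
    by_cases hjT : j ∈ T
    · exact hS0 σ z hz j hjT
    · refine hScone σ (fun z => z.2 j = 0) ⟨?_, ?_⟩ ?_ z hz
      · intro z w hz hw
        simp [hz, hw]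
      · intro c z _ hz
        simp [hz]
      · intro z hz
        obtain ⟨a, ha, rfl⟩ := Finset.mem_image.1 hz
        split_ifs <;> simp [hT a ha j hj hjT]
  let W₀ : Finset (J →₀ k) := G.powerset.biUnion fun σ => (S' σ).image Prod.snd
  have hW₀ : ∀ σ ⊆ G, ∀ z ∈ S' σ, z.2 ∈ W₀ := fun σ hσ z hz =>
    Finset.mem_biUnion.2 ⟨σ, Finset.mem_powerset.2 hσ, Finset.mem_image_of_mem _ hz⟩
  have hW₀I : ∀ w ∈ W₀, w ∈ supportedOn k I := by
    intro w hw
    obtain ⟨σ, _, hw⟩ := Finset.mem_biUnion.1 hw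
    obtain ⟨z, hz, rfl⟩ := Finset.mem_image.1 hw
    exact hS'supp σ z hz
  have hWI : ∀ w ∈ W₀ ∪ W₀.image Neg.neg, w ∈ supportedOn k I := by
    intro w hw
    rcases Finset.mem_union.1 hw with hw | hw
    · exact hW₀I w hw
    · obtain ⟨w, hw', rfl⟩ := Finset.mem_image.1 hw
      intro j hj
      simp [hW₀I w hw' j hj]
  refine ⟨W₀ ∪ W₀.image Neg.neg, hWI, fun s hsI hsG P A hA => ?_⟩
  -- The point x shows that the eliminated system is compatible with `P`. The point y has the same
  -- pattern on `W`, so it satisfies that system too, and changing y only on `T` solves the original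
  -- one without affecting vectors supported on `I`.
  obtain ⟨x, hx⟩ := hsG P (G ∪ (W₀ ∪ W₀.image Neg.neg)) (by rw [Finset.coe_union])
  obtain ⟨y, hy⟩ := hsI P (A.filter (· ∈ supportedOn k I) ∪ (W₀ ∪ W₀.image Neg.neg)) (by
    intro a ha
    rcases Finset.mem_union.1 (Finset.mem_coe.1 ha) with ha | ha
    · exact (Finset.mem_filter.1 ha).2
    · exact hWI a ha)
  let σ := G.filter fun a => P.mem (s a)
  have hσ : σ ⊆ G := Finset.filter_subset _ G
  have hxS : ∀ z ∈ S σ, Satisfies x z := by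
    intro z hz
    obtain ⟨a, ha, rfl⟩ := Finset.mem_image.1 hz
    have hxa := hx a (Finset.mem_union_left _ ha)
    by_cases h : P.mem (s a)
    · simpa [σ, ha, h, Satisfies, ltOrLe] using hxa.2 h
    · have := not_lt.1 (fun h' => h (hxa.1 h'))
      simpa [σ, ha, h, Satisfies, ltOrLe, linFunctional_neg] using this
  have hxS' := hScone σ _ (isConeClosed_satisfies x) hxS
  have hyS' : ∀ z ∈ S' σ, Satisfies y z := by
    rintro ⟨_ | _, w⟩ hz
    -- The weak condition 0 ≤ w is the negation of 0 < -w, hence the negatives in `W`.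
    · have hw : -w ∈ W₀ ∪ W₀.image Neg.neg :=
        Finset.mem_union_right _ (Finset.mem_image_of_mem _ (hW₀ σ hσ _ hz))
      have h1 := hxS' _ hz
      have h2 := (hy _ (Finset.mem_union_right _ hw)).trans
        (hx _ (Finset.mem_union_right _ hw)).symm
      simp only [Satisfies, ltOrLe, linFunctional_neg, Bool.false_eq_true, if_false, neg_pos] at *
      exact not_lt.1 fun h => h1.not_gt (h2.1 h)
    · have hw : w ∈ W₀ ∪ W₀.image Neg.neg := Finset.mem_union_left _ (hW₀ σ hσ _ hz)
      have h1 := hxS' _ hz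
      have h2 := (hy _ (Finset.mem_union_right _ hw)).trans
        (hx _ (Finset.mem_union_right _ hw)).symm
      simp only [Satisfies, ltOrLe, if_true] at *
      exact h2.2 h1
  obtain ⟨z, hzy, hzS⟩ := hSsol σ y hyS'
  refine ⟨z, fun a ha => ?_⟩
  by_cases haI : a ∈ supportedOn k I
  · rw [← hy a (Finset.mem_union_left _ (Finset.mem_filter.2 ⟨ha, haI⟩)),
      linFunctional_congr fun j hj => hzy j fun hjT => hj (haI j (Finset.mem_filter.1 hjT).2)]
  · have haG : a ∈ G := (hA ha).resolve_left haI
    have hza := hzS _ (Finset.mem_image_of_mem _ haG)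
    by_cases h : P.mem (s a)
    · refine iff_of_true ?_ h
      simpa [σ, haG, h, Satisfies, ltOrLe] using hza
    · refine iff_of_false (not_lt.2 ?_) h
      simpa [σ, haG, h, Satisfies, ltOrLe, linFunctional_neg] using hza

/-- A realizable extension of the assignment `s₀`, from the vectors supported on `I`, to finitely
many further vectors. -/
structure PartialAssignment (I : Set J) (s₀ : (J →₀ k) → L) where
  /-- The further vectors. -/
  dom : Finset (J →₀ k)
  /-- The extended assignment. -/
  val : (J →₀ k) → L
  neg_mem : ∀ a ∈ dom, -a ∈ dom
  val_eq : ∀ a ∈ supportedOn k I, val a = s₀ a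
  realizable : Realizable (supportedOn k I ∪ dom) val

namespace PartialAssignment

variable {I : Set J} {s₀ : (J →₀ k) → L}

instance : Preorder (PartialAssignment I s₀) where
  le p q := p.dom ⊆ q.dom ∧ ∀ a ∈ p.dom, q.val a = p.val a
  le_refl p := ⟨subset_rfl, fun _ _ => rfl⟩
  le_trans p q r h h' := ⟨h.1.trans h'.1, fun a ha => (h'.2 a (h.1 ha)).trans (h.2 a ha)⟩

theorem neg_mem_union (p : PartialAssignment I s₀) {a : J →₀ k}
    (ha : a ∈ supportedOn k I ∪ (p.dom : Set (J →₀ k))) :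
    -a ∈ supportedOn k I ∪ (p.dom : Set (J →₀ k)) := by
  rcases ha with ha | ha
  · left
    intro j hj
    simp [ha j hj]
  · exact Or.inr (p.neg_mem a ha)

/-- Adjoining b and -b together keeps the domain symmetric. Both values are free: neither vector is
in the old domain, and b = -b would force b = 0, which is supported on `I`. -/
theorem exists_le_of_realizable (p : PartialAssignment I s₀) {b : J →₀ k}
    (hb : b ∉ supportedOn k I ∪ (p.dom : Set (J →₀ k))) (u v : L)
    (h : ∀ s : (J →₀ k) → L, s b = u → s (-b) = v →
      (∀ a ∈ supportedOn k I ∪ (p.dom : Set (J →₀ k)), s a = p.val a) →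
      Realizable (supportedOn k I ∪ (p.dom ∪ {b, -b} : Set (J →₀ k))) s) :
    ∃ q, p ≤ q ∧ b ∈ q.dom ∧ q.val b = u := by
  classical
  have hb' : -b ∉ supportedOn k I ∪ (p.dom : Set (J →₀ k)) := fun h =>
    hb (by simpa using p.neg_mem_union h)
  have hne : b ≠ -b := by
    intro he
    apply hb
    left
    intro j _
    have := DFunLike.congr_fun he j
    rw [Finsupp.neg_apply] at this
    exact self_eq_neg.1 this
  let s := Function.update (Function.update p.val b u) (-b) v
  have hsb : s b = u := by simp [s, hne]
  have hs : ∀ a ∈ supportedOn k I ∪ (p.dom : Set (J →₀ k)), s a = p.val a := by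
    intro a ha
    have h1 : a ≠ b := fun h => hb (h ▸ ha)
    have h2 : a ≠ -b := fun h => hb' (h ▸ ha)
    simp [s, h1, h2]
  refine ⟨⟨p.dom ∪ {b, -b}, s, ?_, fun a ha => (hs a (Or.inl ha)).trans (p.val_eq a ha), ?_⟩,
    ⟨Finset.subset_union_left, fun a ha => hs a (Or.inr ha)⟩, by simp, hsb⟩
  · intro a ha
    simp only [Finset.mem_union, Finset.mem_insert, Finset.mem_singleton] at ha ⊢
    rcases ha with ha | rfl | rfl
    · exact Or.inl (p.neg_mem a ha)
    · simp
    · simp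
  · have := h s hsb (by simp [s]) hs
    simpa using this

/-- For a new vector, the values are chosen against `p.dom` and the symmetrized test set `W` alone;
the choice of `W` makes them compatible with all vectors supported on `I`. -/
theorem exists_le_mem_dom (hL : CompletelyNormal L) (p : PartialAssignment I s₀) (b : J →₀ k) :
    ∃ q, p ≤ q ∧ b ∈ q.dom := by
  classical
  by_cases hb : b ∈ supportedOn k I ∪ (p.dom : Set (J →₀ k))
  · refine ⟨⟨p.dom ∪ {b, -b}, p.val, ?_, p.val_eq, p.realizable.mono ?_⟩,
      ⟨Finset.subset_union_left, fun _ _ => rfl⟩, by simp⟩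
    · intro a ha
      simp only [Finset.mem_union, Finset.mem_insert, Finset.mem_singleton] at ha ⊢
      rcases ha with ha | rfl | rfl
      · exact Or.inl (p.neg_mem a ha)
      · simp
      · simp
    · intro a ha
      simp only [Finset.coe_union, Finset.coe_insert, Finset.coe_singleton] at ha
      rcases ha with ha | ha | rfl | rfl
      · exact Or.inl ha
      · exact Or.inr ha
      · exact hb
      · exact p.neg_mem_union hb
  obtain ⟨W, hWI, hW⟩ := exists_finset_realizable_union (L := L) I (p.dom ∪ {b, -b})
  let F := p.dom ∪ (W ∪ W.image Neg.neg)
  have hFsub : (F : Set (J →₀ k)) ⊆ supportedOn k I ∪ (p.dom : Set (J →₀ k)) := by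
    intro a ha
    simp only [F, Finset.coe_union, Finset.coe_image] at ha
    rcases ha with ha | ha | ⟨a, ha, rfl⟩
    · exact Or.inr ha
    · exact Or.inl (hWI ha)
    · exact p.neg_mem_union (Or.inl (hWI ha))
  have hFneg : ∀ a ∈ F, -a ∈ F := by
    intro a ha
    simp only [F, Finset.mem_union, Finset.mem_image] at ha ⊢
    rcases ha with ha | ha | ⟨a, ha, rfl⟩
    · exact Or.inl (p.neg_mem a ha)
    · exact Or.inr (Or.inr ⟨a, ha, rfl⟩)
    · exact Or.inr (Or.inl (by rwa [neg_neg]))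
  obtain ⟨u, v, huv⟩ := (p.realizable.mono hFsub).exists_finite_extension hL hFneg b
  obtain ⟨q, hq, hbq, _⟩ := p.exists_le_of_realizable hb u v (by
    intro s hsb hsb' hs
    have := hW s ((p.realizable.mono Set.subset_union_left).congr fun a ha => hs a (Or.inl ha)) (by
      intro P A hA
      obtain ⟨x, hx, hxu, hxv⟩ := huv P
      refine ⟨x, fun a ha => ?_⟩
      have hF : a ∈ F → (0 < linFunctional a x ↔ P.mem (s a)) := fun haF => by
        rw [hx a haF, hs a (hFsub haF)]
      have ha' := hA ha
      simp only [Finset.coe_union, Finset.coe_insert, Finset.coe_singleton] at ha'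
      rcases ha' with (ha | rfl | rfl) | ha
      · exact hF (Finset.mem_union_left _ ha)
      · rw [hsb, hxu]
      · rw [hsb', ← hxv, linFunctional_neg, neg_pos]
      · exact hF (Finset.mem_union_right _ (Finset.mem_union_left _ ha)))
    simpa using this)
  exact ⟨q, hq, hbq⟩

/-- The coordinate vector at a fresh j is independent of the old domain: setting the j-th coordinate
of a realizing point to 1 or 0 according to c leaves the old pattern intact. The opposite vector
gets `⊥`, matching the fact that it is never positive at these points. -/
theorem exists_le_val_eq (hI : Iᶜ.Infinite) (p : PartialAssignment I s₀) (c : L) :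
    ∃ q, p ≤ q ∧ ∃ a ∈ q.dom, q.val a = c := by
  classical
  obtain ⟨j, hjI, hj⟩ := hI.exists_notMem_finset (p.dom.biUnion Finsupp.support)
  have hzero : ∀ a ∈ supportedOn k I ∪ (p.dom : Set (J →₀ k)), a j = 0 := by
    rintro a (ha | ha)
    · exact ha j hjI
    · by_contra hne
      exact hj (Finset.mem_biUnion.2 ⟨a, ha, Finsupp.mem_support_iff.2 hne⟩)
  have hb : Finsupp.single j (1 : k) ∉ supportedOn k I ∪ (p.dom : Set (J →₀ k)) := fun h => by
    simpa using hzero _ h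
  obtain ⟨q, hq, hqb, hqc⟩ := p.exists_le_of_realizable hb c ⊥ (by
    intro s hsb hsb' hs P A hA
    obtain ⟨x, hx⟩ := p.realizable P
      (A.filter (· ∈ supportedOn k I ∪ (p.dom : Set (J →₀ k))))
      (fun a ha => (Finset.mem_filter.1 ha).2)
    refine ⟨x.update j (if P.mem c then 1 else 0), fun a ha => ?_⟩
    by_cases haF : a ∈ supportedOn k I ∪ (p.dom : Set (J →₀ k))
    · rw [hs a haF, ← hx a (Finset.mem_filter.2 ⟨ha, haF⟩)]
      rw [linFunctional_congr (y := x)]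
      intro i hi
      have : i ≠ j := fun h => hi (h ▸ hzero a haF)
      simp [this]
    · have : a = Finsupp.single j 1 ∨ a = -Finsupp.single j 1 := by
        rcases hA ha with h | h | h
        · exact absurd (Or.inl h) haF
        · exact absurd (Or.inr h) haF
        · exact h
      rcases this with rfl | rfl
      · rw [hsb, linFunctional_single]
        by_cases h : P.mem c <;> simp [h]
      · rw [hsb', linFunctional_neg, linFunctional_single]
        by_cases h : P.mem c <;> simp [h, P.not_mem_bot])
  exact ⟨q, hq, _, hqb, hqc⟩

end PartialAssignment

/-- A realizable assignment on the vectors supported on `I` extends to a surjective one on all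
vectors, provided that the complement of `I` is infinite. -/
theorem Realizable.exists_surjective_extension [Countable k] [Countable J] [Countable L]
    (hL : CompletelyNormal L) {I : Set J} (hI : Iᶜ.Infinite) {s₀ : (J →₀ k) → L}
    (hs₀ : Realizable (supportedOn k I) s₀) :
    ∃ s : (J →₀ k) → L, Realizable Set.univ s ∧ (∀ a ∈ supportedOn k I, s a = s₀ a) ∧
      Function.Surjective s := by
  classical
  -- Countably many cofinal demands: every vector enters the domain, and every element of `L`
  -- becomes a value.
  let D : (J →₀ k) ⊕ L → Order.Cofinal (PartialAssignment I s₀) := Sum.elim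
    (fun b => ⟨{p | b ∈ p.dom}, fun p =>
      let ⟨q, hq, hb⟩ := p.exists_le_mem_dom hL b
      ⟨q, hb, hq⟩⟩)
    (fun c => ⟨{p | ∃ a ∈ p.dom, p.val a = c}, fun p =>
      let ⟨q, hq, hc⟩ := p.exists_le_val_eq hI c
      ⟨q, hc, hq⟩⟩)
  let _ : Encodable ((J →₀ k) ⊕ L) := Encodable.ofCountable _
  let p₀ : PartialAssignment I s₀ := ⟨∅, s₀, by simp, fun _ _ => rfl, by simpa using hs₀⟩
  let p := Order.sequenceOfCofinals p₀ D
  have hp : Monotone p := Order.sequenceOfCofinals.monotone p₀ D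
  -- The demand with code n is met at stage n + 1.
  let N : (J →₀ k) → ℕ := fun b => Encodable.encode (Sum.inl b : (J →₀ k) ⊕ L) + 1
  have hN : ∀ b, b ∈ (p (N b)).dom := fun b =>
    Order.sequenceOfCofinals.encode_mem p₀ D (Sum.inl b)
  have hval : ∀ b n, b ∈ (p n).dom → (p n).val b = (p (N b)).val b := by
    intro b n hb
    rw [← (hp (le_max_left n (N b))).2 b hb, (hp (le_max_right n (N b))).2 b (hN b)]
  refine ⟨fun b => (p (N b)).val b, ?_, fun a ha => (p (N a)).val_eq a ha, ?_⟩
  · intro P A _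
    have hA : ∀ a ∈ A, a ∈ (p (A.sup N)).dom := fun a ha =>
      (hp (Finset.le_sup (f := N) ha)).1 (hN a)
    obtain ⟨x, hx⟩ := (p (A.sup N)).realizable P A fun a ha => Or.inr (hA a ha)
    exact ⟨x, fun a ha => by rw [hx a ha, hval a _ (hA a ha)]⟩
  · intro c
    obtain ⟨a, ha, hac⟩ : ∃ a ∈ (p (Encodable.encode (Sum.inr c : (J →₀ k) ⊕ L) + 1)).dom, _ :=
      Order.sequenceOfCofinals.encode_mem p₀ D (Sum.inr c)
    exact ⟨a, (hval a _ ha).symm.trans hac⟩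

end Extension

/-! ### Surjective homomorphisms from realizable assignments, and subadditive assignments -/

section ExtensionHom

set_option linter.unusedSectionVars false

variable {k : Type*} [DivisionRing k] [LinearOrder k] [IsStrictOrderedRing k]
  {J : Type*} {L : Type*} [DistribLattice L] [OrderBot L]

theorem subtypeDomain_mapDomain_val {I : Set J} (a : I →₀ k) :
    (a.mapDomain Subtype.val).subtypeDomain (· ∈ I) = a := by
  ext i
  exact Finsupp.mapDomain_apply Subtype.val_injective a i

/-- A realizable assignment on `k^(I)` extends to a surjective homomorphism on
`Op⁻(k^(J), k^(J))`. -/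
theorem Realizable.exists_surjective_latticeHom [Countable k] [Countable J] [Countable L]
    (hL : CompletelyNormal L) {I : Set J} (hI : Iᶜ.Infinite) {t : (I →₀ k) → L}
    (ht : Realizable Set.univ t) :
    ∃ g : LatticeHom (OpSpace k J) L, (∀ c, ∃ a, g (halfSpace a) = c) ∧
      ∀ a : I →₀ k, g (halfSpace (a.mapDomain Subtype.val)) = t a := by
  classical
  have hs₀ : Realizable (supportedOn k I) fun a => t (a.subtypeDomain (· ∈ I)) := by
    intro P A hA
    obtain ⟨x, hx⟩ := ht P (A.image fun a => a.subtypeDomain (· ∈ I)) (Set.subset_univ _)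
    refine ⟨x.mapDomain Subtype.val, fun a ha => ?_⟩
    have e : (a.subtypeDomain (· ∈ I)).mapDomain Subtype.val = a := by
      ext j
      by_cases hj : j ∈ I
      · exact Finsupp.mapDomain_apply Subtype.val_injective _ (⟨j, hj⟩ : I)
      · rw [hA ha j hj, Finsupp.mapDomain_of_notMem_range _ _ (by simpa using hj)]
    rw [← hx _ (Finset.mem_image_of_mem _ ha)]
    conv_lhs => rw [← e, linFunctional_mapDomain, subtypeDomain_mapDomain_val]
  obtain ⟨s, hs, hsI, hsurj⟩ := hs₀.exists_surjective_extension hL hI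
  obtain ⟨g, hg⟩ := hs.exists_latticeHom
  refine ⟨g, fun c => ?_, fun a => ?_⟩
  · obtain ⟨a, ha⟩ := hsurj c
    exact ⟨a, (hg a).trans ha⟩
  · rw [hg, hsI, subtypeDomain_mapDomain_val]
    intro j hj
    exact Finsupp.mapDomain_of_notMem_range _ _ (by simpa using hj)

theorem eps_halfSpace (I : Set J) (a : I →₀ k) :
    eps k I (halfSpace a) = halfSpace (a.mapDomain Subtype.val) := by
  refine Subtype.ext (Set.ext fun y => ?_)
  change 0 < linFunctional a (y.subtypeDomain (· ∈ I)) ↔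
    0 < linFunctional (a.mapDomain Subtype.val) y
  rw [linFunctional_mapDomain]

/-- An assignment that is positively homogeneous, subadditive, and orthogonal on opposite vectors
is realizable. -/
theorem realizable_of_subadditive (t : (J →₀ k) → L)
    (smul : ∀ (c : k) a, 0 < c → t (c • a) = t a)
    (add : ∀ a b, t (a + b) ≤ t a ⊔ t b) (neg : ∀ a, t a ⊓ t (-a) = ⊥) :
    Realizable Set.univ t := by
  classical
  intro P A _
  have hneg : ∀ a, P.mem (t a) → ¬ P.mem (t (-a)) := fun a h h' =>
    P.not_mem_bot (neg a ▸ P.mem_inf.2 ⟨h, h'⟩)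
  have hadd : ∀ {a b}, P.mem (t (a + b)) → P.mem (t a) ∨ P.mem (t b) := fun h =>
    P.mem_sup.1 (P.mem_of_le (add _ _) h)
  have hweak : ∀ {a b}, P.mem (t a) → ¬ P.mem (t (-b)) → P.mem (t (a + b)) := fun {a b} h h' =>
    (hadd (a := a + b) (b := -b) (by simpa using h)).resolve_right h'
  -- Positivity as `P` sees it: a is positive if t a ∈ P, and nonnegative if t (-a) ∉ P.
  let p : Bool × (J →₀ k) → Prop := fun z =>
    if z.1 then P.mem (t z.2) else ¬ P.mem (t (-z.2))
  have hp : IsConeClosed p := by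
    constructor
    · rintro ⟨_ | _, a⟩ ⟨_ | _, b⟩ h h' <;>
        simp only [p, Bool.or_true, Bool.or_false, if_true, Bool.false_eq_true, if_false] at *
      · intro hab
        rw [neg_add] at hab
        exact (hadd hab).elim h h'
      · rw [add_comm]
        exact hweak h' h
      · exact hweak h h'
      · exact hweak h (hneg b h')
    · rintro c ⟨_ | _, a⟩ hc h <;>
        simp only [p, if_true, Bool.false_eq_true, if_false] at *
      · rwa [← smul_neg, smul c _ hc]
      · rwa [smul c _ hc]
  -- Eliminating every variable leaves only zero functionals. A strict condition among them would
  -- put t 0 in `P`, against t 0 ⊓ t (-0) = ⊥; so the origin satisfies the reduced system and the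
  -- original one is solvable.
  obtain ⟨S', h0, hcone, hsol⟩ := exists_eliminate (A.biUnion Finsupp.support)
    (A.image fun a => if P.mem (t a) then (true, a) else (false, -a))
  have hzero : ∀ z ∈ S', z.2 = 0 := by
    intro z hz
    ext j
    by_cases hj : j ∈ A.biUnion Finsupp.support
    · exact h0 z hz j hj
    · refine hcone (fun z => z.2 j = 0) ⟨?_, ?_⟩ ?_ z hz
      · intro z w hz hw
        simp [hz, hw]
      · intro c z _ hz
        simp [hz]
      · intro z hz
        obtain ⟨a, ha, rfl⟩ := Finset.mem_image.1 hz
        have : a j = 0 := by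
          by_contra hne
          exact hj (Finset.mem_biUnion.2 ⟨a, ha, Finsupp.mem_support_iff.2 hne⟩)
        split_ifs <;> simp [this]
  have hpS' := hcone p hp (by
    intro z hz
    obtain ⟨a, ha, rfl⟩ := Finset.mem_image.1 hz
    split_ifs with h <;> simp [p, h])
  obtain ⟨x, -, hx⟩ := hsol 0 (by
    rintro ⟨_ | _, a⟩ hz
    · simp [Satisfies, ltOrLe, linFunctional_apply_zero]
    · have hz0 : a = 0 := hzero _ hz
      have : P.mem (t a) := by simpa [p] using hpS' _ hz
      subst hz0
      exact absurd (by simpa using this) (hneg 0 this))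
  refine ⟨x, fun a ha => ?_⟩
  have := hx _ (Finset.mem_image_of_mem _ ha)
  by_cases h : P.mem (t a)
  · refine iff_of_true ?_ h
    simpa [h, Satisfies, ltOrLe] using this
  · refine iff_of_false (not_lt.2 ?_) h
    simpa [h, Satisfies, ltOrLe, linFunctional_neg] using this

end ExtensionHom

/-! ### Principal ideals of vector lattices -/

section PositiveParts

variable {k : Type*} [DivisionRing k] [LinearOrder k] [IsStrictOrderedRing k]
variable {V : Type*} [AddCommGroup V] [Lattice V] [IsOrderedAddMonoid V] [Module k V]
  [PosSMulMono k V]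

theorem Idc.mk_mono {a b : V} (ha : 0 ≤ a) (hab : a ≤ b) : Idc.mk k a ≤ Idc.mk k b :=
  Idc.mk_le_mk.2 ⟨1, zero_le_one, by
    rwa [one_smul, abs_of_nonneg ha, abs_of_nonneg (ha.trans hab)]⟩

theorem Idc.mk_abs (a : V) : Idc.mk k |a| = Idc.mk k a :=
  le_antisymm (Idc.mk_le_mk.2 ⟨1, zero_le_one, by simp⟩)
    (Idc.mk_le_mk.2 ⟨1, zero_le_one, by simp⟩)

theorem Idc.mk_smul {c : k} (hc : 0 < c) {a : V} (ha : 0 ≤ a) : Idc.mk k (c • a) = Idc.mk k a := by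
  have hca : 0 ≤ c • a := smul_nonneg hc.le ha
  refine le_antisymm (Idc.mk_le_mk.2 ⟨c, hc.le, ?_⟩)
    (Idc.mk_le_mk.2 ⟨c⁻¹, (inv_pos.2 hc).le, ?_⟩)
  · rw [abs_of_nonneg ha, abs_of_nonneg hca]
  · rw [abs_of_nonneg ha, abs_of_nonneg hca, inv_smul_smul₀ hc.ne']

theorem Idc.mk_sup_of_nonneg {a b : V} (ha : 0 ≤ a) (hb : 0 ≤ b) :
    Idc.mk k (a ⊔ b) = Idc.mk k a ⊔ Idc.mk k b := by
  refine le_antisymm ?_ (sup_le (Idc.mk_mono ha le_sup_left) (Idc.mk_mono hb le_sup_right))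
  rw [Idc.mk_sup_mk, abs_of_nonneg ha, abs_of_nonneg hb]
  exact Idc.mk_mono (ha.trans le_sup_left)
    (sup_le (le_add_of_nonneg_right hb) (le_add_of_nonneg_left ha))

theorem Idc.mk_inf_of_nonneg {a b : V} (ha : 0 ≤ a) (hb : 0 ≤ b) :
    Idc.mk k (a ⊓ b) = Idc.mk k a ⊓ Idc.mk k b := by
  rw [Idc.mk_inf_mk, abs_of_nonneg ha, abs_of_nonneg hb]

theorem Idc.mk_eq_sup (a : V) : Idc.mk k a = Idc.mk k (a ⊔ 0) ⊔ Idc.mk k (-a ⊔ 0) := by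
  rw [Idc.mk_sup_mk, abs_of_nonneg le_sup_right, abs_of_nonneg le_sup_right, ← Idc.mk_abs]
  exact congrArg (Idc.mk k) (posPart_add_negPart a).symm

theorem Idc.mk_sup_zero_inf_mk_neg_sup_zero (a : V) :
    Idc.mk k (a ⊔ 0) ⊓ Idc.mk k (-a ⊔ 0) = ⊥ := by
  rw [← Idc.mk_inf_of_nonneg le_sup_right le_sup_right]
  exact congrArg (Idc.mk k) (posPart_inf_negPart_eq_zero a)

theorem Idc.mk_add_sup_zero_le (a b : V) :
    Idc.mk k ((a + b) ⊔ 0) ≤ Idc.mk k (a ⊔ 0) ⊔ Idc.mk k (b ⊔ 0) := by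
  rw [Idc.mk_sup_mk, abs_of_nonneg le_sup_right, abs_of_nonneg le_sup_right]
  exact Idc.mk_mono le_sup_right
    (sup_le (add_le_add le_sup_left le_sup_left) (add_nonneg le_sup_right le_sup_right))

end PositiveParts

/-! ### Linear elements and cozero sets in free vector lattices -/

namespace FreeVL

set_option linter.unusedSectionVars false

variable {k : Type*} [DivisionRing k] [LinearOrder k] [IsStrictOrderedRing k] {X : Type*}

/-- The vector space `k^(X)` in the free vector lattice on `X`. -/
noncomputable def linear : (X →₀ k) →ₗ[k] FreeVL k X := Finsupp.linearCombination k of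

theorem linear_single (x : X) (c : k) : linear (Finsupp.single x c) = c • (of x : FreeVL k X) :=
  Finsupp.linearCombination_single k c x

/-- Points of k^(X) act on the free vector lattice by evaluation into `k`; on linear elements this
is the pairing that defines the half-spaces. -/
theorem lift_linear (x a : X →₀ k) :
    (lift (k := k) (x : X → k)).toLinearMap (linear a) = linFunctional a x := by
  unfold linear
  rw [Finsupp.apply_linearCombination, Finsupp.linearCombination_apply]
  rfl

theorem inclusion_linear {J : Type*} (I : Set J) (a : I →₀ k) :
    (inclusion k I).toLinearMap (linear a) = linear (a.mapDomain Subtype.val) := by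
  unfold linear
  rw [Finsupp.apply_linearCombination, Finsupp.linearCombination_mapDomain]
  rfl

/-- Translations distribute over both lattice operations, which reduces the claim to sums of linear
elements. -/
theorem add_mem_latticeClosure {a b : FreeVL k X}
    (ha : a ∈ latticeClosure (Set.range (linear (k := k) (X := X))))
    (hb : b ∈ latticeClosure (Set.range (linear (k := k) (X := X)))) :
    a + b ∈ latticeClosure (Set.range (linear (k := k) (X := X))) := by
  induction ha using latticeClosure_sup_inf_induction with
  | mem a ha =>
    obtain ⟨a, rfl⟩ := ha
    induction hb using latticeClosure_sup_inf_induction with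
    | mem b hb =>
      obtain ⟨b, rfl⟩ := hb
      exact subset_latticeClosure ⟨a + b, map_add _ _ _⟩
    | sup b _ c _ ihb ihc =>
      rw [add_sup]
      exact isSublattice_latticeClosure.supClosed ihb ihc
    | inf b _ c _ ihb ihc =>
      rw [add_inf]
      exact isSublattice_latticeClosure.infClosed ihb ihc
  | sup a _ c _ iha ihc =>
    rw [sup_add]
    exact isSublattice_latticeClosure.supClosed iha ihc
  | inf a _ c _ iha ihc =>
    rw [inf_add]
    exact isSublattice_latticeClosure.infClosed iha ihc

theorem neg_mem_latticeClosure {a : FreeVL k X}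
    (ha : a ∈ latticeClosure (Set.range (linear (k := k) (X := X)))) :
    -a ∈ latticeClosure (Set.range (linear (k := k) (X := X))) := by
  induction ha using latticeClosure_sup_inf_induction with
  | mem a ha =>
    obtain ⟨a, rfl⟩ := ha
    exact subset_latticeClosure ⟨-a, map_neg _ _⟩
  | sup a _ c _ iha ihc =>
    rw [neg_sup]
    exact isSublattice_latticeClosure.infClosed iha ihc
  | inf a _ c _ iha ihc =>
    rw [neg_inf]
    exact isSublattice_latticeClosure.supClosed iha ihc

theorem smul_mem_latticeClosure_of_nonneg {r : k} (hr : 0 ≤ r) {a : FreeVL k X}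
    (ha : a ∈ latticeClosure (Set.range (linear (k := k) (X := X)))) :
    r • a ∈ latticeClosure (Set.range (linear (k := k) (X := X))) := by
  induction ha using latticeClosure_sup_inf_induction with
  | mem a ha =>
    obtain ⟨a, rfl⟩ := ha
    exact subset_latticeClosure ⟨r • a, map_smul _ _ _⟩
  | sup a _ c _ iha ihc =>
    rw [VectorLattice.smul_sup hr]
    exact isSublattice_latticeClosure.supClosed iha ihc
  | inf a _ c _ iha ihc =>
    rw [VectorLattice.smul_inf hr]
    exact isSublattice_latticeClosure.infClosed iha ihc

theorem smul_mem_latticeClosure (r : k) {a : FreeVL k X}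
    (ha : a ∈ latticeClosure (Set.range (linear (k := k) (X := X)))) :
    r • a ∈ latticeClosure (Set.range (linear (k := k) (X := X))) := by
  rcases le_total 0 r with hr | hr
  · exact smul_mem_latticeClosure_of_nonneg hr ha
  · have := neg_mem_latticeClosure (smul_mem_latticeClosure_of_nonneg (neg_nonneg.2 hr) ha)
    rwa [neg_smul, neg_neg] at this

/-- Every element of the free vector lattice is a lattice combination of linear elements. -/
theorem mem_latticeClosure_linear (a : FreeVL k X) :
    a ∈ latticeClosure (Set.range (linear (k := k) (X := X))) := by
  obtain ⟨t⟩ := a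
  induction t with
  | of x => exact subset_latticeClosure ⟨Finsupp.single x 1, by rw [linear_single, one_smul]; rfl⟩
  | zero => exact subset_latticeClosure ⟨0, map_zero _⟩
  | add a b iha ihb => exact add_mem_latticeClosure iha ihb
  | neg a iha => exact neg_mem_latticeClosure iha
  | smul r a iha => exact smul_mem_latticeClosure r iha
  | sup a b iha ihb => exact isSublattice_latticeClosure.supClosed iha ihb
  | inf a b iha ihb => exact isSublattice_latticeClosure.infClosed iha ihb

/-- The ideal ⟨a⟩ is ⟨a⁺⟩ ∨ ⟨(-a)⁺⟩, and a ↦ ⟨a⁺⟩ preserves joins and meets, so lattice words in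
linear elements suffice. -/
theorem idc_induction {p : Idc k (FreeVL k X) → Prop}
    (linear : ∀ a : X →₀ k, p (Idc.mk k (linear a ⊔ 0)))
    (sup : ∀ S T, p S → p T → p (S ⊔ T)) (inf : ∀ S T, p S → p T → p (S ⊓ T))
    (S : Idc k (FreeVL k X)) : p S := by
  have key : ∀ a : FreeVL k X, p (Idc.mk k (a ⊔ 0)) := by
    intro a
    induction mem_latticeClosure_linear a using latticeClosure_sup_inf_induction with
    | mem a ha =>
      obtain ⟨a, rfl⟩ := ha
      exact linear a
    | sup a _ b _ iha ihb =>
      rw [sup_sup_distrib_right, Idc.mk_sup_of_nonneg le_sup_right le_sup_right]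
      exact sup _ _ iha ihb
    | inf a _ b _ iha ihb =>
      have e : (a ⊓ b) ⊔ 0 = (a ⊔ 0) ⊓ (b ⊔ 0) :=
        @sup_inf_right _ (AddCommGroup.toDistribLattice (FreeVL k X)) a b 0
      rw [e, Idc.mk_inf_of_nonneg le_sup_right le_sup_right]
      exact inf _ _ iha ihb
  obtain ⟨a, rfl⟩ := Idc.exists_mk S
  rw [Idc.mk_eq_sup]
  exact sup _ _ (key a) (key (-a))

/-- The set of points of `k^(X)` where some element of a principal `ℓ`-ideal of the free vector
lattice does not vanish. -/
def cozeroSet (S : Idc k (FreeVL k X)) : Set (X →₀ k) :=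
  {x | ∃ t ∈ (S : Submodule k (FreeVL k X)), (lift (k := k) (x : X → k)).toLinearMap t ≠ 0}

/-- A bound |t| ≤ c|a| survives evaluation, so where a vanishes the whole ideal vanishes. -/
theorem mem_cozeroSet_mk {a : FreeVL k X} {x : X →₀ k} :
    x ∈ cozeroSet (Idc.mk k a) ↔ (lift (k := k) (x : X → k)).toLinearMap a ≠ 0 := by
  refine ⟨?_, fun h => ⟨a, self_mem_principalLIdeal a, h⟩⟩
  rintro ⟨t, ⟨c, _, ht⟩, hne⟩ h0
  have := (lift (k := k) (x : X → k)).mono ht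
  rw [map_smul, VectorLatticeHom.map_abs, VectorLatticeHom.map_abs, h0, abs_zero, smul_zero] at this
  exact hne (abs_nonpos_iff.1 this)

theorem cozeroSet_sup (S T : Idc k (FreeVL k X)) :
    cozeroSet (S ⊔ T) = cozeroSet S ∪ cozeroSet T := by
  obtain ⟨a, rfl⟩ := Idc.exists_mk S
  obtain ⟨b, rfl⟩ := Idc.exists_mk T
  ext x
  rw [Idc.mk_sup_mk, Set.mem_union, mem_cozeroSet_mk, mem_cozeroSet_mk, mem_cozeroSet_mk, map_add,
    VectorLatticeHom.map_abs, VectorLatticeHom.map_abs, ← not_and_or, not_iff_not,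
    add_eq_zero_iff_of_nonneg (abs_nonneg _) (abs_nonneg _), abs_eq_zero, abs_eq_zero]

theorem cozeroSet_inf (S T : Idc k (FreeVL k X)) :
    cozeroSet (S ⊓ T) = cozeroSet S ∩ cozeroSet T := by
  obtain ⟨a, rfl⟩ := Idc.exists_mk S
  obtain ⟨b, rfl⟩ := Idc.exists_mk T
  ext x
  have h := (lift (k := k) (x : X → k)).map_inf' |a| |b|
  change (lift (k := k) (x : X → k)).toLinearMap (|a| ⊓ |b|) =
    (lift (k := k) (x : X → k)).toLinearMap |a| ⊓ (lift (k := k) (x : X → k)).toLinearMap |b| at h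
  rw [Idc.mk_inf_mk, Set.mem_inter_iff, mem_cozeroSet_mk, mem_cozeroSet_mk, mem_cozeroSet_mk, h,
    VectorLatticeHom.map_abs, VectorLatticeHom.map_abs]
  rw [← abs_pos (a := (lift (k := k) (x : X → k)).toLinearMap a),
    ← abs_pos (a := (lift (k := k) (x : X → k)).toLinearMap b), ← lt_inf_iff]
  exact ⟨fun h => lt_of_le_of_ne (le_inf (abs_nonneg _) (abs_nonneg _)) h.symm, ne_of_gt⟩

theorem cozeroSet_mk_linear_sup_zero (a : X →₀ k) :
    cozeroSet (Idc.mk k (linear a ⊔ 0)) = halfSpace a := by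
  ext x
  have h := (lift (k := k) (x : X → k)).map_sup' (linear a) 0
  change (lift (k := k) (x : X → k)).toLinearMap (linear a ⊔ 0) =
    (lift (k := k) (x : X → k)).toLinearMap (linear a) ⊔
      (lift (k := k) (x : X → k)).toLinearMap 0 at h
  rw [mem_cozeroSet_mk, h, map_zero, lift_linear]
  change _ ↔ 0 < linFunctional a x
  rw [Ne, sup_eq_right, not_le]

theorem cozeroSet_mem (S : Idc k (FreeVL k X)) : cozeroSet S ∈ OpSpace k X := by
  induction S using idc_induction with
  | linear a =>
    rw [cozeroSet_mk_linear_sup_zero]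
    exact (halfSpace a).2
  | sup S T hS hT =>
    rw [cozeroSet_sup]
    exact (OpSpace k X).sup_mem hS hT
  | inf S T hS hT =>
    rw [cozeroSet_inf]
    exact (OpSpace k X).inf_mem hS hT

variable (k X) in
/-- The canonical homomorphism from `Id_c F_ℓ(X, k)` to `Op⁻(k^(X), k^(X))`. -/
def cozeroHom : LatticeHom (Idc k (FreeVL k X)) (OpSpace k X) where
  toFun S := ⟨cozeroSet S, cozeroSet_mem S⟩
  map_sup' S T := Subtype.ext (cozeroSet_sup S T)
  map_inf' S T := Subtype.ext (cozeroSet_inf S T)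

theorem cozeroHom_mk_linear_sup_zero (a : X →₀ k) :
    cozeroHom k X (Idc.mk k (linear a ⊔ 0)) = halfSpace a :=
  Subtype.ext (cozeroSet_mk_linear_sup_zero a)

theorem eta_mk_linear_sup_zero {J : Type*} (I : Set J) (a : I →₀ k) :
    eta k I (Idc.mk k (linear a ⊔ 0)) = Idc.mk k (linear (a.mapDomain Subtype.val) ⊔ 0) := by
  have h := (inclusion k I).map_sup' (linear a) 0
  change (inclusion k I).toLinearMap (linear a ⊔ 0) =
    (inclusion k I).toLinearMap (linear a) ⊔ (inclusion k I).toLinearMap 0 at h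
  rw [eta, idcMap_mk, h, map_zero, inclusion_linear]

/-- This rests on ⟨(ca)⁺⟩ = ⟨a⁺⟩ for c > 0, (a + b)⁺ ≤ a⁺ + b⁺ and a⁺ ∧ (-a)⁺ = 0. -/
theorem realizable_of_idc {L : Type*} [DistribLattice L] [OrderBot L]
    (f : LatticeHom (Idc k (FreeVL k X)) L) (hf : f ⊥ = ⊥) :
    Realizable Set.univ fun a : X →₀ k => f (Idc.mk k (linear a ⊔ 0)) := by
  refine realizable_of_subadditive _ ?_ ?_ ?_
  · intro c a hc
    have e : linear (c • a) ⊔ 0 = c • (linear a ⊔ (0 : FreeVL k X)) := by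
      rw [VectorLattice.smul_sup hc.le, smul_zero, map_smul]
    rw [e, Idc.mk_smul hc le_sup_right]
  · intro a b
    rw [← map_sup, map_add]
    exact OrderHomClass.mono f (Idc.mk_add_sup_zero_le _ _)
  · intro a
    rw [← map_inf, map_neg, Idc.mk_sup_zero_inf_mk_neg_sup_zero, hf]

end FreeVL

theorem theoremT
    {k : Type*} [DivisionRing k] [LinearOrder k] [IsStrictOrderedRing k] [Countable k]
    {J : Type*} [Countable J] (I : Set J) (hI : (Iᶜ : Set J).Infinite)
    {K : Type*} [DistribLattice K] [OrderBot K]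
    {L : Type*} [DistribLattice L] [OrderBot L] [Countable L] (hL : CompletelyNormal L)
    (φ : LatticeHom K L) (hφ : φ ⊥ = ⊥) :
    (∀ f : LatticeHom (OpSpace k I) K, f ⊥ = ⊥ →
      ∃ g : LatticeHom (OpSpace k J) L,
        Function.Surjective g ∧ g.comp (eps k I) = φ.comp f) ∧
    (∀ f : LatticeHom (Idc k (FreeVL k I)) K, f ⊥ = ⊥ →
      ∃ g : LatticeHom (Idc k (FreeVL k J)) L,
        Function.Surjective g ∧ g.comp (eta k I) = φ.comp f) := by
  constructor
  · intro f hf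
    obtain ⟨g, hsurj, hg⟩ := (realizable_of_latticeHom (φ.comp f)
      (by simp [hf, hφ])).exists_surjective_latticeHom hL hI
    refine ⟨g, fun c => (hsurj c).imp' _ fun _ h => h, LatticeHom.ext fun X => ?_⟩
    induction X using OpSpace.induction with
    | half a => rw [LatticeHom.comp_apply, eps_halfSpace, hg]
    | sup X Y hX hY => rw [map_sup, map_sup, hX, hY]
    | inf X Y hX hY => rw [map_inf, map_inf, hX, hY]
  · intro f hf
    obtain ⟨g, hsurj, hg⟩ := (FreeVL.realizable_of_idc (φ.comp f)
      (by simp [hf, hφ])).exists_surjective_latticeHom hL hI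
    -- Only g factors through `Op⁻`; the identity with φ ∘ f is checked on the generators ⟨a⁺⟩, a
    -- linear.
    refine ⟨g.comp (FreeVL.cozeroHom k J), fun c => ?_, LatticeHom.ext fun S => ?_⟩
    · obtain ⟨a, ha⟩ := hsurj c
      exact ⟨_, by rw [LatticeHom.comp_apply, FreeVL.cozeroHom_mk_linear_sup_zero, ha]⟩
    · induction S using FreeVL.idc_induction with
      | linear a =>
        rw [LatticeHom.comp_apply, LatticeHom.comp_apply, FreeVL.eta_mk_linear_sup_zero,
          FreeVL.cozeroHom_mk_linear_sup_zero, hg]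
      | sup S T hS hT => rw [map_sup, map_sup, hS, hT]
      | inf S T hS hT => rw [map_inf, map_inf, hS, hT]
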